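/- **Setting.** Let $\mathcal X,\widetilde{\mathcal X},\mathcal Y$ be finite sets, $P_X$ a probability distribution on $\mathcal X$ and $P_{\widetilde XY|X}$ a (broadcast) channel from $\mathcal X$ to $\widetilde{\mathcal X}\times\mathcal Y$. Let $(X^n,\widetilde X^n,Y^n)$ be i.i.d. with law $P_XP_{\widetilde XY|X}$. Logarithms are natural, and entropy $H$ and mutual information $I$ are in nats. *Generated-secret (GS) model:* an encoder $f:\widetilde{\mathcal X}^n\to\mathcal W\times\mathcal S$ and a decoder $g:\mathcal W\times\mathcal Y^n\to\mathcal S$ with finite $\mathcal W,\mathcal S$; put $(W,S)=f(\widetilde X^n)$ and $\hat S=g(W,Y^n)$. *Chosen-secret (CS) model:* $S$ is uniform on a finite set $\mathcal S$ and independent of $(X^n,\widetilde X^n,Y^n)$; the encoder is $f:\widetilde{\mathcal X}^n\times\mathcal S\to\mathcal W$, and $W=f(\widetilde X^n,S)$, $\hat S=g(W,Y^n)$. A tuple $(R_s,R_\ell,R_w)\in\mathbb R^3$ is *achievable* for a model if for every $\delta>0$ there are $n\ge1$, an encoder and a decoder with $R_s=\frac1n\log|\mathcal S|$ and $$\Pr[S\neq\hat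 S]\le\delta,\quad I(S;W)\le\delta,\quad \tfrac1nI(X^n;W)\le R_\ell+\delta,\quad \tfrac1nH(S)\ge R_s-\delta,\quad \tfrac1n\log|\mathcal W|\le R_w+\delta .$$ The key-leakage-storage regions $\mathcal C_{\rm gs}$ and $\mathcal C_{\rm cs}$ are the closures of the sets of achievable tuples. For a finite set $\mathcal U$ and a channel $P_{U|\widetilde X}$ from $\widetilde{\mathcal X}$ to $\mathcal U$, let $(U,X,\widetilde X,Y)$ have the law $P_{U|\widetilde X}P_XP_{\widetilde XY|X}$, so that $U-\widetilde X-XY$ is a Markov chain. Let $$\mathcal R_{\rm gs}=\bigcup_{P_{U|\widetilde X}}\bigl\{(R_s,R_\ell,R_w):\ 0\le R_s\le I(U;Y),\ R_\ell\ge\max\{0,I(U;X)-I(U;Y)\},\ R_w\ge I(U;\widetilde X)-I(U;Y)\bigr\},$$ $$\mathcal R_{\rm cs}=\bigcup_{P_{U|\widetilde X}}\bigl\{(R_s,R_\ell,R_w):\ 0\le R_s\le I(U;Y),\ R_\ell\ge\max\{0,I(U;X)-I(U;Y)\},\ R_w\ge I(U;\widetilde X)\bigr\}.$$ Let $\mathcal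 R_1$ and $\mathcal R_2$ be the parts of the union $\mathcal R_{\rm gs}$ that come from the $P_{U|\widetilde X}$ for which $\max\{0,I(U;X)-I(U;Y)\}$ is positive and zero, respectively, and let $\mathcal R_3$ and $\mathcal R_4$ be the corresponding parts of $\mathcal R_{\rm cs}$. **Theorem.** 1. $\mathcal R_{\rm gs}\subseteq\mathcal C_{\rm gs}$ and $\mathcal R_{\rm cs}\subseteq\mathcal C_{\rm cs}$. 2. None of $\mathcal R_1,\mathcal R_2,\mathcal R_3,\mathcal R_4$ changes if the union is restricted to $|\mathcal U|\le|\widetilde{\mathcal X}|+2$. 3. For every $P_{U|\widetilde X}$ there is a $P_{U'|\widetilde X}$ with $|\mathcal U'|\le|\widetilde{\mathcal X}|+1$, $I(U';Y)=I(U;Y)$ and $I(U';\widetilde X)=I(U;\widetilde X)$. If $I(U;X)\le I(U;Y)$ for all $P_{U|\widetilde X}$, then $\mathcal R_2$ and $\mathcal R_4$ do not change if the union is restricted to $|\mathcal U|\le|\widetilde{\mathcal X}|+1$. -/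

import Mathlib

noncomputable section

namespace KeyAgreement

/-! ### Finite information theory (natural logarithms throughout) -/

/-- Shannon entropy of a distribution on a finite set, `-∑ p(a) log p(a)`. -/
def shannonEntropy {α : Type*} [Fintype α] (p : PMF α) : ℝ :=
  ∑ a, Real.negMulLog (p a).toReal

/-- Entropy `H(A)` of a random variable `A` on a discrete probability space `(Ω, p)`. -/
def rvEntropy {Ω α : Type*} [Fintype α] (p : PMF Ω) (A : Ω → α) : ℝ :=
  shannonEntropy (p.map A)

/-- Mutual information `I(A;B) = H(A) + H(B) - H(A,B)`. -/
def mutualInfo {Ω α β : Type*} [Fintype α] [Fintype β] (p : PMF Ω) (A : Ω → α) (B : Ω → β) : ℝ :=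
  rvEntropy p A + rvEntropy p B - rvEntropy p (fun ω => (A ω, B ω))

/-- Probability of an event. -/
def prob {Ω : Type*} (p : PMF Ω) (E : Set Ω) : ℝ := (p.toOuterMeasure E).toReal

/-- The `n`-fold product distribution `z ↦ ∏ i, p (z i)`. -/
def iid {α : Type*} [Fintype α] (p : PMF α) (n : ℕ) : PMF (Fin n → α) :=
  PMF.ofFintype (fun z => ∏ i, p (z i)) (by
    have h : ∑ a, p a = 1 := by rw [← tsum_fintype (L := .unconditional _)]; exact p.tsum_coe
    rw [← Fintype.piFinset_univ, ← Finset.prod_univ_sum]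
    simp [h])

section Model

variable {X Xt Y : Type*} [Fintype X] [Fintype Xt] [Fintype Y]

/-- Joint law of `(X, X̃, Y)`: `X ∼ P_X`, then `(X̃, Y)` is the output of the broadcast channel
`P_{X̃Y|X}` with input `X`. -/
def sourceLaw (PX : PMF X) (BC : X → PMF (Xt × Y)) : PMF (X × Xt × Y) :=
  PX.bind fun x => (BC x).map fun z => (x, z)

/-! ### Codes and achievability -/

/-- The conditions on a block length `n`, a key `S`, a key estimate `S'` (both with values in a set
of size `MS`) and helper data `W` (with values in a set of size `MW`) for the rate tuple
`R = (R_s, R_ℓ, R_w)` and the tolerance `δ`. -/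
def MeetsConstraints {Ω : Type*} (p : PMF Ω) {n MS MW : ℕ} (Xn : Ω → Fin n → X)
    (S S' : Ω → Fin MS) (W : Ω → Fin MW) (R : ℝ × ℝ × ℝ) (δ : ℝ) : Prop :=
  R.1 = Real.log MS / n ∧
  prob p {ω | S ω ≠ S' ω} ≤ δ ∧
  mutualInfo p S W ≤ δ ∧
  mutualInfo p Xn W / n ≤ R.2.1 + δ ∧
  R.1 - δ ≤ rvEntropy p S / n ∧
  Real.log MW / n ≤ R.2.2 + δ

/-- Generated-secret model: the encoder computes helper data and key from `X̃ⁿ`, the decoder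
estimates the key from the helper data and `Yⁿ`. -/
def AchievableGS (PX : PMF X) (BC : X → PMF (Xt × Y)) (R : ℝ × ℝ × ℝ) : Prop :=
  ∀ δ : ℝ, 0 < δ → ∃ (n MW MS : ℕ), 1 ≤ n ∧
    ∃ (f : (Fin n → Xt) → Fin MW × Fin MS) (g : Fin MW × (Fin n → Y) → Fin MS),
      MeetsConstraints (iid (sourceLaw PX BC) n)
        (fun z i => (z i).1)
        (fun z => (f fun i => (z i).2.1).2)
        (fun z => g ((f fun i => (z i).2.1).1, fun i => (z i).2.2))
        (fun z => (f fun i => (z i).2.1).1)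
        R δ

/-- Chosen-secret model: probability space of `n` source symbols together with an independent
key that is uniformly distributed. -/
def chosenLaw (PX : PMF X) (BC : X → PMF (Xt × Y)) (n MS : ℕ) [NeZero MS] :
    PMF ((Fin n → X × Xt × Y) × Fin MS) :=
  (iid (sourceLaw PX BC) n).bind fun z => (PMF.uniformOfFintype (Fin MS)).map fun s => (z, s)

/-- Chosen-secret model: the encoder computes helper data from `X̃ⁿ` and the given key, the decoder
estimates the key from the helper data and `Yⁿ`. -/
def AchievableCS (PX : PMF X) (BC : X → PMF (Xt × Y)) (R : ℝ × ℝ × ℝ) : Prop :=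
  ∀ δ : ℝ, 0 < δ → ∃ (n MW MS : ℕ) (_ : NeZero MS), 1 ≤ n ∧
    ∃ (f : (Fin n → Xt) × Fin MS → Fin MW) (g : Fin MW × (Fin n → Y) → Fin MS),
      MeetsConstraints (chosenLaw PX BC n MS)
        (fun ω i => (ω.1 i).1)
        (fun ω => ω.2)
        (fun ω => g (f (fun i => (ω.1 i).2.1, ω.2), fun i => (ω.1 i).2.2))
        (fun ω => f (fun i => (ω.1 i).2.1, ω.2))
        R δ

/-- Key-leakage-storage region of the generated-secret model. -/
def capacityGS (PX : PMF X) (BC : X → PMF (Xt × Y)) : Set (ℝ × ℝ × ℝ) :=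
  closure {R | AchievableGS PX BC R}

/-- Key-leakage-storage region of the chosen-secret model. -/
def capacityCS (PX : PMF X) (BC : X → PMF (Xt × Y)) : Set (ℝ × ℝ × ℝ) :=
  closure {R | AchievableCS PX BC R}

/-! ### The single-letter regions -/

/-- Joint law of `(U, (X, X̃, Y))`, where `U` is the output of the channel `P_{U|X̃} = Q` with input
`X̃`; thus `U - X̃ - (X, Y)` is a Markov chain. -/
def auxLaw (PX : PMF X) (BC : X → PMF (Xt × Y)) {m : ℕ} (Q : Xt → PMF (Fin m)) :
    PMF (Fin m × X × Xt × Y) :=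
  (sourceLaw PX BC).bind fun z => (Q z.2.1).map fun u => (u, z)

/-- `I(U;X)`. -/
def infoUX (PX : PMF X) (BC : X → PMF (Xt × Y)) {m : ℕ} (Q : Xt → PMF (Fin m)) : ℝ :=
  mutualInfo (auxLaw PX BC Q) (fun ω => ω.1) (fun ω => ω.2.1)

/-- `I(U;X̃)`. -/
def infoUXt (PX : PMF X) (BC : X → PMF (Xt × Y)) {m : ℕ} (Q : Xt → PMF (Fin m)) : ℝ :=
  mutualInfo (auxLaw PX BC Q) (fun ω => ω.1) (fun ω => ω.2.2.1)

/-- `I(U;Y)`. -/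
def infoUY (PX : PMF X) (BC : X → PMF (Xt × Y)) {m : ℕ} (Q : Xt → PMF (Fin m)) : ℝ :=
  mutualInfo (auxLaw PX BC Q) (fun ω => ω.1) (fun ω => ω.2.2.2)

/-- Rate tuples `(R_s, R_ℓ, R_w)` of the generated-secret model for a fixed `P_{U|X̃}`. -/
def ratesGS (PX : PMF X) (BC : X → PMF (Xt × Y)) {m : ℕ} (Q : Xt → PMF (Fin m)) :
    Set (ℝ × ℝ × ℝ) :=
  {R | 0 ≤ R.1 ∧ R.1 ≤ infoUY PX BC Q ∧
    max 0 (infoUX PX BC Q - infoUY PX BC Q) ≤ R.2.1 ∧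
    infoUXt PX BC Q - infoUY PX BC Q ≤ R.2.2}

/-- Rate tuples `(R_s, R_ℓ, R_w)` of the chosen-secret model for a fixed `P_{U|X̃}`. -/
def ratesCS (PX : PMF X) (BC : X → PMF (Xt × Y)) {m : ℕ} (Q : Xt → PMF (Fin m)) :
    Set (ℝ × ℝ × ℝ) :=
  {R | 0 ≤ R.1 ∧ R.1 ≤ infoUY PX BC Q ∧
    max 0 (infoUX PX BC Q - infoUY PX BC Q) ≤ R.2.1 ∧
    infoUXt PX BC Q ≤ R.2.2}

/-- `R_gs`: union over all finite alphabets of `U` and all `P_{U|X̃}`. -/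
def regionGS (PX : PMF X) (BC : X → PMF (Xt × Y)) : Set (ℝ × ℝ × ℝ) :=
  ⋃ (m : ℕ) (Q : Xt → PMF (Fin m)), ratesGS PX BC Q

/-- `R_cs`: union over all finite alphabets of `U` and all `P_{U|X̃}`. -/
def regionCS (PX : PMF X) (BC : X → PMF (Xt × Y)) : Set (ℝ × ℝ × ℝ) :=
  ⋃ (m : ℕ) (Q : Xt → PMF (Fin m)), ratesCS PX BC Q

/-- `R_1`, with `|U| ≤ k` (`k = ⊤`: no bound): the part of `R_gs` that comes from the `P_{U|X̃}`
for which `max {0, I(U;X) - I(U;Y)}` is positive. -/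
def region1 (PX : PMF X) (BC : X → PMF (Xt × Y)) (k : ℕ∞) : Set (ℝ × ℝ × ℝ) :=
  ⋃ (m : ℕ) (_ : (m : ℕ∞) ≤ k) (Q : Xt → PMF (Fin m))
    (_ : 0 < max 0 (infoUX PX BC Q - infoUY PX BC Q)), ratesGS PX BC Q

/-- `R_2`, with `|U| ≤ k`: the part of `R_gs` that comes from the `P_{U|X̃}` for which
`max {0, I(U;X) - I(U;Y)}` is zero. -/
def region2 (PX : PMF X) (BC : X → PMF (Xt × Y)) (k : ℕ∞) : Set (ℝ × ℝ × ℝ) :=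
  ⋃ (m : ℕ) (_ : (m : ℕ∞) ≤ k) (Q : Xt → PMF (Fin m))
    (_ : max 0 (infoUX PX BC Q - infoUY PX BC Q) = 0), ratesGS PX BC Q

/-- `R_3`, with `|U| ≤ k`: the part of `R_cs` that comes from the `P_{U|X̃}` for which
`max {0, I(U;X) - I(U;Y)}` is positive. -/
def region3 (PX : PMF X) (BC : X → PMF (Xt × Y)) (k : ℕ∞) : Set (ℝ × ℝ × ℝ) :=
  ⋃ (m : ℕ) (_ : (m : ℕ∞) ≤ k) (Q : Xt → PMF (Fin m))
    (_ : 0 < max 0 (infoUX PX BC Q - infoUY PX BC Q)), ratesCS PX BC Q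

/-- `R_4`, with `|U| ≤ k`: the part of `R_cs` that comes from the `P_{U|X̃}` for which
`max {0, I(U;X) - I(U;Y)}` is zero. -/
def region4 (PX : PMF X) (BC : X → PMF (Xt × Y)) (k : ℕ∞) : Set (ℝ × ℝ × ℝ) :=
  ⋃ (m : ℕ) (_ : (m : ℕ∞) ≤ k) (Q : Xt → PMF (Fin m))
    (_ : max 0 (infoUX PX BC Q - infoUY PX BC Q) = 0), ratesCS PX BC Q

end Model

end KeyAgreement

end

/-!
Quantize `X̃ⁿ` to a codeword of a random codebook drawn from the law of `U`, and hash the index of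
that codeword at random into the helper data and the key. By the covering lemma some codeword is
likely to look as if it came from the Markov chain `U - X̃ - (X, Y)`; binning lets the decoder
recover its index from the helper data and `Yⁿ`; and a leftover hash lemma bounds the secrecy
deficit `log |S| - H(S | W)`, which dominates both `I(S; W)` and `log |S| - H(S)`. All error terms
are exponentially small, by Chernoff bounds on the information densities. In the chosen-secret
model the generated key serves as a one-time pad, and the deficit also bounds what it leaks.

As for the size of `U`, each information is a constant minus the sum over `u` of a continuous,
positively homogeneous function of the vector `P(U = u, X̃ = ·)`. Carathéodory's theorem for cones
preserves the sum of these vectors and `k` such sums with `|X̃| + k` letters, and connectedness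
saves one letter, as in the Fenchel-Eggleston theorem.
-/

noncomputable section

namespace KeyAgreement

section Weights

variable {Ω α β γ : Type*}

open Classical in
/-- The mass of an event `E` under a real weight `p` on a finite set. All probabilities, laws and
entropies of the proof are computed with real weights; probability distributions are the elements
of `stdSimplex`. -/
def pr [Fintype Ω] (p : Ω → ℝ) (E : Ω → Prop) : ℝ := ∑ ω, if E ω then p ω else 0

/-- The law of the random variable `A` under the weight `p`. -/
def law [Fintype Ω] (p : Ω → ℝ) (A : Ω → α) (a : α) : ℝ := pr p fun ω => A ω = a

/-- The conditional probability `P(A = a | B = b)` under the weight `p`, with the junk value `0` if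
`P(B = b) = 0`. -/
def condLaw [Fintype Ω] (p : Ω → ℝ) (B : Ω → β) (A : Ω → α) (b : β) (a : α) : ℝ :=
  law p (fun ω => (A ω, B ω)) (a, b) / law p B b

/-- The entropy `H(A)` under the weight `p`. -/
def ent [Fintype Ω] [Fintype α] (p : Ω → ℝ) (A : Ω → α) : ℝ := ∑ a, Real.negMulLog (law p A a)

/-- The mutual information `I(A;B)` under the weight `p`. -/
def info [Fintype Ω] [Fintype α] [Fintype β] (p : Ω → ℝ) (A : Ω → α) (B : Ω → β) : ℝ :=
  ent p A + ent p B - ent p fun ω => (A ω, B ω)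

/-- The secrecy deficit `log |α| - H(A|B)`: it vanishes if and only if `A` is uniform and
independent of `B`. -/
def deficit [Fintype Ω] [Fintype α] [Fintype β] (p : Ω → ℝ) (A : Ω → α) (B : Ω → β) : ℝ :=
  Real.log (Fintype.card α) + ent p B - ent p fun ω => (A ω, B ω)

variable [Fintype Ω] {p : Ω → ℝ}

lemma pr_congr {E F : Ω → Prop} (h : ∀ ω, E ω ↔ F ω) : pr p E = pr p F :=
  congrArg (pr p) (funext fun ω => propext (h ω))

lemma pr_eq_zero {E : Ω → Prop} (h : ∀ ω, ¬E ω) : pr p E = 0 := by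
  simp [pr, h]

lemma pr_nonneg (hp : ∀ ω, 0 ≤ p ω) (E : Ω → Prop) : 0 ≤ pr p E := by
  classical exact Finset.sum_nonneg fun ω _ => ite_nonneg (hp ω) le_rfl

lemma pr_mono (hp : ∀ ω, 0 ≤ p ω) {E F : Ω → Prop} (h : ∀ ω, 0 < p ω → E ω → F ω) :
    pr p E ≤ pr p F := by
  refine Finset.sum_le_sum fun ω _ => ?_
  rcases (hp ω).eq_or_lt with h0 | h0
  · simp [← h0]
  · by_cases hE : E ω
    · simp [hE, h ω h0 hE]
    · simp only [hE, if_false]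
      split_ifs
      exacts [h0.le, le_rfl]

lemma pr_add_pr_not (p : Ω → ℝ) (E : Ω → Prop) : pr p E + pr p (fun ω => ¬E ω) = ∑ ω, p ω := by
  rw [pr, pr, ← Finset.sum_add_distrib]
  exact Finset.sum_congr rfl fun ω _ => by by_cases h : E ω <;> simp [h]

lemma pr_le_one (hp : p ∈ stdSimplex ℝ Ω) (E : Ω → Prop) : pr p E ≤ 1 := by
  linarith [pr_add_pr_not p E, pr_nonneg hp.1 fun ω => ¬E ω, hp.2]

lemma pr_not (hp : p ∈ stdSimplex ℝ Ω) (E : Ω → Prop) : pr p (fun ω => ¬E ω) = 1 - pr p E := by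
  linarith [pr_add_pr_not p E, hp.2]

lemma pr_or_le (hp : ∀ ω, 0 ≤ p ω) (E F : Ω → Prop) :
    pr p (fun ω => E ω ∨ F ω) ≤ pr p E + pr p F := by
  rw [pr, pr, pr, ← Finset.sum_add_distrib]
  refine Finset.sum_le_sum fun ω _ => ?_
  by_cases h : E ω <;> by_cases h' : F ω <;> simp [h, h', hp ω]

lemma pr_exists_le [Fintype α] (hp : ∀ ω, 0 ≤ p ω) (E : α → Ω → Prop) :
    pr p (fun ω => ∃ a, E a ω) ≤ ∑ a, pr p (E a) := by
  classical
  simp only [pr]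
  rw [Finset.sum_comm]
  refine Finset.sum_le_sum fun ω _ => ?_
  split_ifs with h
  · obtain ⟨a, ha⟩ := h
    refine le_trans ?_ (Finset.single_le_sum (fun a _ => ite_nonneg (hp ω) le_rfl)
      (Finset.mem_univ a))
    simp [ha]
  · exact Finset.sum_nonneg fun a _ => ite_nonneg (hp ω) le_rfl

lemma sum_pr_eq_and [Fintype α] (p : Ω → ℝ) (A : Ω → α) (E : Ω → Prop) :
    ∑ a, pr p (fun ω => A ω = a ∧ E ω) = pr p E := by
  classical
  simp only [pr]
  rw [Finset.sum_comm]
  refine Finset.sum_congr rfl fun ω _ => ?_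
  by_cases h : E ω <;> simp [h]

lemma sum_mul_pr_comm [Fintype α] (p : Ω → ℝ) (q : α → ℝ) (E : α → Ω → Prop) :
    ∑ a, q a * pr p (E a) = ∑ ω, p ω * pr q fun a => E a ω := by
  classical
  simp only [pr, Finset.mul_sum]
  rw [Finset.sum_comm]
  refine Finset.sum_congr rfl fun ω _ => Finset.sum_congr rfl fun a _ => ?_
  rw [mul_ite, mul_ite, mul_zero, mul_zero, mul_comm]

lemma law_nonneg (hp : ∀ ω, 0 ≤ p ω) (A : Ω → α) (a : α) : 0 ≤ law p A a :=
  pr_nonneg hp _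

lemma law_pos (hp : ∀ ω, 0 ≤ p ω) (A : Ω → α) {ω : Ω} (h : 0 < p ω) : 0 < law p A (A ω) := by
  classical
  refine h.trans_le ?_
  simpa [law, pr] using Finset.single_le_sum (f := fun ω' => if A ω' = A ω then p ω' else 0)
    (fun ω' _ => ite_nonneg (hp ω') le_rfl) (Finset.mem_univ ω)

lemma sum_law_mul [Fintype α] (p : Ω → ℝ) (A : Ω → α) (f : α → ℝ) :
    ∑ a, law p A a * f a = ∑ ω, p ω * f (A ω) := by
  classical
  simp only [law, pr, Finset.sum_mul]
  rw [Finset.sum_comm]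
  exact Finset.sum_congr rfl fun ω _ => by simp [ite_mul]

lemma law_mem_stdSimplex [Fintype α] (hp : p ∈ stdSimplex ℝ Ω) (A : Ω → α) :
    law p A ∈ stdSimplex ℝ α :=
  ⟨law_nonneg hp.1 A, by simpa [hp.2] using sum_law_mul p A fun _ => 1⟩

lemma sum_law_pair_left [Fintype α] (p : Ω → ℝ) (A : Ω → α) (B : Ω → β) (b : β) :
    ∑ a, law p (fun ω => (A ω, B ω)) (a, b) = law p B b := by
  simpa only [law, Prod.mk.injEq] using sum_pr_eq_and p A fun ω => B ω = b

lemma law_pair_le_left (hp : ∀ ω, 0 ≤ p ω) (A : Ω → α) (B : Ω → β) (a : α) (b : β) :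
    law p (fun ω => (A ω, B ω)) (a, b) ≤ law p A a :=
  pr_mono hp fun _ _ h => (Prod.ext_iff.1 h).1

lemma law_pair_le_right (hp : ∀ ω, 0 ≤ p ω) (A : Ω → α) (B : Ω → β) (a : α) (b : β) :
    law p (fun ω => (A ω, B ω)) (a, b) ≤ law p B b :=
  pr_mono hp fun _ _ h => (Prod.ext_iff.1 h).2

lemma condLaw_nonneg (hp : ∀ ω, 0 ≤ p ω) (B : Ω → β) (A : Ω → α) (b : β) (a : α) :
    0 ≤ condLaw p B A b a :=
  div_nonneg (law_nonneg hp _ _) (law_nonneg hp _ _)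

lemma condLaw_pos (hp : ∀ ω, 0 ≤ p ω) (B : Ω → β) (A : Ω → α) {ω : Ω} (h : 0 < p ω) :
    0 < condLaw p B A (B ω) (A ω) :=
  div_pos (law_pos hp (fun ω => (A ω, B ω)) h) (law_pos hp B h)

lemma condLaw_le_one (hp : ∀ ω, 0 ≤ p ω) (B : Ω → β) (A : Ω → α) (b : β) (a : α) :
    condLaw p B A b a ≤ 1 :=
  div_le_one_of_le₀ (law_pair_le_right hp A B a b) (law_nonneg hp B b)

lemma law_mul_condLaw (hp : ∀ ω, 0 ≤ p ω) (B : Ω → β) (A : Ω → α) (b : β) (a : α) :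
    law p B b * condLaw p B A b a = law p (fun ω => (A ω, B ω)) (a, b) := by
  rcases (law_nonneg hp B b).eq_or_lt with h | h
  · rw [← h, zero_mul]
    exact (law_nonneg hp _ _).antisymm ((law_pair_le_right hp A B a b).trans h.ge)
  · rw [condLaw, mul_div_cancel₀ _ h.ne']

lemma nonempty_of_mem_stdSimplex (hp : p ∈ stdSimplex ℝ Ω) : Nonempty Ω := by
  by_contra h
  rw [not_nonempty_iff] at h
  simpa using hp.2

lemma sum_mul_le_of_pos (hp : ∀ ω, 0 ≤ p ω) {f g : Ω → ℝ} (h : ∀ ω, 0 < p ω → f ω ≤ g ω) :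
    ∑ ω, p ω * f ω ≤ ∑ ω, p ω * g ω :=
  Finset.sum_le_sum fun ω _ => (hp ω).eq_or_lt.elim (fun h0 => by simp [← h0])
    fun h0 => mul_le_mul_of_nonneg_left (h ω h0) h0.le

lemma sum_mul_congr_of_pos (hp : ∀ ω, 0 ≤ p ω) {f g : Ω → ℝ} (h : ∀ ω, 0 < p ω → f ω = g ω) :
    ∑ ω, p ω * f ω = ∑ ω, p ω * g ω :=
  (sum_mul_le_of_pos hp fun ω h0 => (h ω h0).le).antisymm
    (sum_mul_le_of_pos hp fun ω h0 => (h ω h0).ge)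

lemma sum_mul_const (hp : p ∈ stdSimplex ℝ Ω) (c : ℝ) : ∑ ω, p ω * c = c := by
  rw [← Finset.sum_mul, hp.2, one_mul]

lemma exists_le_of_sum_mul_le (hp : p ∈ stdSimplex ℝ Ω) {f : Ω → ℝ} {C : ℝ}
    (h : ∑ ω, p ω * f ω ≤ C) : ∃ ω, f ω ≤ C := by
  by_contra! hC
  obtain ⟨ω, hω⟩ : ∃ ω, 0 < p ω := by
    by_contra! h0
    linarith [hp.2, Finset.sum_nonpos fun ω (_ : ω ∈ Finset.univ) => h0 ω]
  have : ∑ ω, p ω * C < ∑ ω, p ω * f ω :=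
    Finset.sum_lt_sum (fun ω _ => mul_le_mul_of_nonneg_left (hC ω).le (hp.1 ω))
      ⟨ω, Finset.mem_univ ω, mul_lt_mul_of_pos_left (hC ω) hω⟩
  linarith [sum_mul_const hp C]

lemma exists_add_mul_le_of_sum_mul_le {μ f g : Ω → ℝ} (hμ : μ ∈ stdSimplex ℝ Ω) {a b ν : ℝ}
    (hν : 0 ≤ ν) (hf : ∑ ω, μ ω * f ω ≤ a) (hg : ∑ ω, μ ω * g ω ≤ b) :
    ∃ ω, f ω + ν * g ω ≤ a + ν * b := by
  refine exists_le_of_sum_mul_le hμ ?_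
  simp only [mul_add, Finset.sum_add_distrib, mul_left_comm _ ν]
  rw [← Finset.mul_sum]
  gcongr

lemma sum_mul_log_le_log (hp : p ∈ stdSimplex ℝ Ω) {f : Ω → ℝ} (hf : ∀ ω, 0 < p ω → 0 < f ω)
    {C : ℝ} (hC : 0 < C) (h : ∑ ω, p ω * f ω ≤ C) : ∑ ω, p ω * Real.log (f ω) ≤ Real.log C := by
  have tangent : ∀ ω, 0 < p ω → Real.log (f ω) ≤ Real.log C - 1 + f ω / C := fun ω h0 => by
    have := Real.log_le_sub_one_of_pos (div_pos (hf ω h0) hC)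
    rw [Real.log_div (hf ω h0).ne' hC.ne'] at this
    linarith
  calc ∑ ω, p ω * Real.log (f ω)
      ≤ ∑ ω, p ω * (Real.log C - 1 + f ω / C) := sum_mul_le_of_pos hp.1 tangent
    _ = Real.log C - 1 + (∑ ω, p ω * f ω) / C := by
        simp only [mul_add, Finset.sum_add_distrib, sum_mul_const hp, Finset.sum_div, mul_div_assoc]
    _ ≤ Real.log C := by linarith [(div_le_one hC).2 h]

variable [Fintype α] [Fintype β] [Fintype γ]

lemma ent_eq_sum (p : Ω → ℝ) (A : Ω → α) : ent p A = -∑ ω, p ω * Real.log (law p A (A ω)) := by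
  rw [← sum_law_mul p A fun a => Real.log (law p A a), ← Finset.sum_neg_distrib]
  exact Finset.sum_congr rfl fun a _ => by rw [Real.negMulLog, neg_mul]

lemma ent_le_log_sub_sum_mul_log (hp : p ∈ stdSimplex ℝ Ω) (A : Ω → α) {f : α → ℝ}
    (hf : ∀ a, 0 ≤ f a) (hf' : ∀ ω, 0 < p ω → 0 < f (A ω)) {C : ℝ} (hC : 0 < C)
    (h : ∑ a, f a ≤ C) : ent p A ≤ Real.log C - ∑ ω, p ω * Real.log (f (A ω)) := by
  have ratio_le : ∑ ω, p ω * (f (A ω) / law p A (A ω)) ≤ C := by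
    rw [← sum_law_mul p A fun a => f a / law p A a]
    refine (Finset.sum_le_sum fun a _ => ?_).trans h
    rcases (law_nonneg hp.1 A a).eq_or_lt with h0 | h0
    · simp [← h0, hf a]
    · rw [mul_div_cancel₀ _ h0.ne']
  have jensen := sum_mul_log_le_log hp (fun ω h0 => div_pos (hf' ω h0) (law_pos hp.1 A h0)) hC
    ratio_le
  have split := sum_mul_congr_of_pos hp.1 fun ω h0 =>
    Real.log_div (hf' ω h0).ne' (law_pos hp.1 A h0).ne'
  rw [split] at jensen
  simp only [mul_sub, Finset.sum_sub_distrib] at jensen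
  rw [ent_eq_sum]
  linarith

lemma ent_le_log_card (hp : p ∈ stdSimplex ℝ Ω) (A : Ω → α) :
    ent p A ≤ Real.log (Fintype.card α) := by
  have : Nonempty α := (nonempty_of_mem_stdSimplex hp).map A
  simpa using ent_le_log_sub_sum_mul_log hp A (f := fun _ => 1) (by simp) (by simp)
    (Nat.cast_pos.2 Fintype.card_pos) (by simp)

lemma ent_pair_le (hp : p ∈ stdSimplex ℝ Ω) (A : Ω → α) (B : Ω → β) :
    ent p (fun ω => (A ω, B ω)) ≤ ent p A + ent p B := by
  have sum_one : ∑ c : α × β, law p A c.1 * law p B c.2 = 1 := by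
    rw [Fintype.sum_prod_type, ← Finset.sum_mul_sum, (law_mem_stdSimplex hp A).2,
      (law_mem_stdSimplex hp B).2, one_mul]
  have gibbs := ent_le_log_sub_sum_mul_log hp (fun ω => (A ω, B ω))
    (fun c => mul_nonneg (law_nonneg hp.1 A c.1) (law_nonneg hp.1 B c.2))
    (fun ω h0 => mul_pos (law_pos hp.1 A h0) (law_pos hp.1 B h0)) one_pos sum_one.le
  have split := sum_mul_congr_of_pos hp.1 fun ω h0 =>
    Real.log_mul (law_pos hp.1 A h0).ne' (law_pos hp.1 B h0).ne'
  rw [split] at gibbs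
  simp only [mul_add, Finset.sum_add_distrib, Real.log_one] at gibbs
  rw [ent_eq_sum p A, ent_eq_sum p B]
  linarith

lemma ent_comp_equiv (p : Ω → ℝ) (A : Ω → α) (e : α ≃ β) :
    ent p (fun ω => e (A ω)) = ent p A := by
  rw [ent, ent, ← e.sum_comp]
  simp only [law, e.apply_eq_iff_eq]

lemma ent_pair_comm (p : Ω → ℝ) (A : Ω → α) (B : Ω → β) :
    ent p (fun ω => (B ω, A ω)) = ent p fun ω => (A ω, B ω) :=
  ent_comp_equiv p (fun ω => (A ω, B ω)) (Equiv.prodComm α β)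

lemma info_comp_equiv_right (p : Ω → ℝ) (A : Ω → α) (B : Ω → β) (e : β ≃ γ) :
    info p A (fun ω => e (B ω)) = info p A B := by
  rw [info, info, ent_comp_equiv, ← ent_comp_equiv p _ ((Equiv.refl α).prodCongr e)]
  rfl

lemma info_comm (p : Ω → ℝ) (A : Ω → α) (B : Ω → β) : info p A B = info p B A := by
  rw [info, info, ent_pair_comm, add_comm (ent p A)]

lemma info_nonneg (hp : p ∈ stdSimplex ℝ Ω) (A : Ω → α) (B : Ω → β) : 0 ≤ info p A B :=
  sub_nonneg.2 (ent_pair_le hp A B)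

lemma info_le_deficit (hp : p ∈ stdSimplex ℝ Ω) (A : Ω → α) (B : Ω → β) :
    info p A B ≤ deficit p A B := by
  rw [info, deficit]
  linarith [ent_le_log_card hp A]

lemma deficit_nonneg (hp : p ∈ stdSimplex ℝ Ω) (A : Ω → α) (B : Ω → β) : 0 ≤ deficit p A B :=
  (info_nonneg hp A B).trans (info_le_deficit hp A B)

lemma log_card_sub_ent_le_deficit (hp : p ∈ stdSimplex ℝ Ω) (A : Ω → α) (B : Ω → β) :
    Real.log (Fintype.card α) - ent p A ≤ deficit p A B := by
  rw [deficit]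
  linarith [ent_pair_le hp A B]

end Weights

section PMF

variable {Ω α β : Type*}

/-- The point masses of a distribution as a real weight. -/
def wt (p : PMF Ω) (ω : Ω) : ℝ := (p ω).toReal

/-- The distribution whose point masses form a given point of the standard simplex. -/
def ofStdSimplex [Fintype Ω] (p : Ω → ℝ) (hp : p ∈ stdSimplex ℝ Ω) : PMF Ω :=
  PMF.ofFintype (fun ω => ENNReal.ofReal (p ω)) (by
    rw [← ENNReal.ofReal_sum_of_nonneg fun ω _ => hp.1 ω, hp.2, ENNReal.ofReal_one])

lemma wt_bind_map {γ : Type*} (p : PMF Ω) (f : Ω → PMF α) {e : Ω → α → γ}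
    (he : Function.Injective2 e) (ω : Ω) (a : α) :
    wt (p.bind fun ω => (f ω).map (e ω)) (e ω a) = wt p ω * wt (f ω) a := by
  classical
  simp only [wt, PMF.bind_apply, PMF.map_apply, he.eq_iff]
  rw [tsum_eq_single ω, tsum_eq_single a]
  · simp
  · intro a' h
    simp [h.symm]
  · intro ω' h
    simp [h.symm]

variable [Fintype Ω]

lemma wt_mem_stdSimplex (p : PMF Ω) : wt p ∈ stdSimplex ℝ Ω := by
  refine ⟨fun _ => ENNReal.toReal_nonneg, ?_⟩
  simp only [wt]
  rw [← ENNReal.toReal_sum fun a _ => p.apply_ne_top a, ← tsum_fintype (L := .unconditional _),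
    p.tsum_coe, ENNReal.toReal_one]

lemma wt_ofStdSimplex {p : Ω → ℝ} (hp : p ∈ stdSimplex ℝ Ω) : wt (ofStdSimplex p hp) = p := by
  ext ω
  simp [wt, ofStdSimplex, hp.1 ω]

lemma prob_eq_pr (p : PMF Ω) (E : Set Ω) : prob p E = pr (wt p) (· ∈ E) := by
  classical
  rw [prob, PMF.toOuterMeasure_apply, tsum_fintype, ENNReal.toReal_sum]
  · refine Finset.sum_congr rfl fun ω _ => ?_
    by_cases h : ω ∈ E <;> simp [h, wt]
  · intro ω _
    by_cases h : ω ∈ E <;> simp [h, p.apply_ne_top]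

lemma wt_map (p : PMF Ω) (A : Ω → α) : wt (p.map A) = law (wt p) A := by
  ext a
  rw [wt, ← PMF.toOuterMeasure_apply_singleton, PMF.toOuterMeasure_map_apply]
  exact prob_eq_pr p _

lemma rvEntropy_eq_ent [Fintype α] (p : PMF Ω) (A : Ω → α) : rvEntropy p A = ent (wt p) A := by
  rw [rvEntropy, shannonEntropy, ent, ← wt_map]
  rfl

lemma mutualInfo_eq_info [Fintype α] [Fintype β] (p : PMF Ω) (A : Ω → α) (B : Ω → β) :
    mutualInfo p A B = info (wt p) A B := by
  simp only [mutualInfo, rvEntropy_eq_ent, info]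

end PMF

section ProductWeights

variable {ι α β : Type*} [Fintype ι]

/-- The product weight on functions `ι → α`, the law of independent copies of `p`. -/
def prodWeight (ι : Type*) [Fintype ι] (p : α → ℝ) (c : ι → α) : ℝ := ∏ j, p (c j)

lemma wt_iid [Fintype α] (p : PMF α) (n : ℕ) : wt (iid p n) = prodWeight (Fin n) (wt p) := by
  ext z
  simp [wt, iid, prodWeight, ENNReal.toReal_prod]

variable [Fintype α] [DecidableEq ι] {p : α → ℝ}

lemma sum_prod_apply (f : ι → α → ℝ) : ∑ c : ι → α, ∏ j, f j (c j) = ∏ j, ∑ a, f j a := by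
  rw [Finset.prod_univ_sum, Fintype.piFinset_univ]

lemma prodWeight_mem_stdSimplex (hp : p ∈ stdSimplex ℝ α) :
    prodWeight ι p ∈ stdSimplex ℝ (ι → α) :=
  ⟨fun _ => Finset.prod_nonneg fun _ _ => hp.1 _, by
    simp only [prodWeight, sum_prod_apply (ι := ι) fun _ => p, hp.2, Finset.prod_const_one]⟩

lemma pr_prod_forall (p : ι → α → ℝ) (E : ι → α → Prop) :
    pr (fun c : ι → α => ∏ j, p j (c j)) (fun c => ∀ j, E j (c j)) = ∏ j, pr (p j) (E j) := by
  classical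
  simp only [pr]
  rw [← sum_prod_apply]
  exact Finset.sum_congr rfl fun c _ => by rw [Finset.prod_ite_zero]; simp

lemma law_prod (p : ι → α → ℝ) (A : α → β) (b : ι → β) :
    law (fun c : ι → α => ∏ j, p j (c j)) (fun c => A ∘ c) b = ∏ j, law (p j) A (b j) := by
  simp only [law, funext_iff]
  exact pr_prod_forall p fun j a => A a = b j

lemma pr_prodWeight_apply (hp : p ∈ stdSimplex ℝ α) (k : ι) (E : α → Prop) :
    pr (prodWeight ι p) (fun c => E (c k)) = pr p E := by
  have h : pr (prodWeight ι p) (fun c => ∀ j, j = k → E (c j)) = _ :=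
    pr_prod_forall (fun _ => p) fun j a => j = k → E a
  rw [Finset.prod_eq_single k _ (by simp)] at h
  · simpa using h
  · intro j _ hj
    simp [hj, pr, hp.2]

end ProductWeights

section ConicReduction

variable {ι E T κ : Type*} [Fintype ι]

lemma exists_nonneg_coeff_of_not_linearIndependent [AddCommGroup E] [Module ℝ E] {w : ι → E}
    (hw : ¬LinearIndependent ℝ w) :
    ∃ c : ι → ℝ, (∀ i, 0 ≤ c i) ∧ (∃ k, c k = 0) ∧ ∑ i, c i • w i = ∑ i, w i := by
  obtain ⟨g, hg, i, hi⟩ := Fintype.not_linearIndependent_iff.1 hw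
  wlog hpos : 0 < g i generalizing g
  · exact this (-g) (by simpa using hg) (by simpa using hi)
      (by simpa using lt_of_le_of_ne (not_lt.1 hpos) hi)
  have : Nonempty ι := ⟨i⟩
  obtain ⟨k, hk⟩ := Finite.exists_max g
  have hgk : 0 < g k := hpos.trans_le (hk i)
  refine ⟨fun j => 1 - g j / g k, fun j => sub_nonneg.2 ((div_le_one hgk).2 (hk j)),
    ⟨k, by simp [hgk.ne']⟩, ?_⟩
  simp only [sub_smul, one_smul, Finset.sum_sub_distrib, div_eq_inv_mul, mul_smul,
    ← Finset.smul_sum, hg, smul_zero, sub_zero]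

lemma exists_tied_max {ι : Type*} [Finite ι] {b : ℝ → ι → ℝ}
    (hb : ∀ i, Continuous fun s => b s i) {i₀ i₁ : ι} (h01 : i₁ ≠ i₀)
    (h0 : ∀ i, b 0 i ≤ b 0 i₀) (h1 : ∀ i, b 1 i ≤ b 1 i₁) :
    ∃ s ∈ Set.Icc (0 : ℝ) 1, ∃ k ≠ i₀, b s k = b s i₀ ∧ ∀ i, b s i ≤ b s k := by
  classical
  cases nonempty_fintype ι
  have hS : (Finset.univ.erase i₀).Nonempty := ⟨i₁, by simp [h01]⟩
  let lead : ℝ → ℝ := fun s => (Finset.univ.erase i₀).sup' hS (b s) - b s i₀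
  have lead_cont : Continuous lead :=
    (Continuous.finset_sup'_apply hS fun i _ => hb i).sub (hb i₀)
  have lead_zero : lead 0 ≤ 0 := sub_nonpos.2 (Finset.sup'_le _ _ fun i _ => h0 i)
  have lead_one : 0 ≤ lead 1 :=
    sub_nonneg.2 ((h1 i₀).trans (Finset.le_sup' (b 1) (Finset.mem_erase.2 ⟨h01, by simp⟩)))
  obtain ⟨s, hs, hs0⟩ :=
    intermediate_value_Icc zero_le_one lead_cont.continuousOn ⟨lead_zero, lead_one⟩
  obtain ⟨k, hk, hks⟩ := Finset.exists_mem_eq_sup' hS (b s)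
  have tie : b s k = b s i₀ := by rw [← hks]; exact sub_eq_zero.1 hs0
  refine ⟨s, hs, k, Finset.ne_of_mem_erase hk, tie, fun i => ?_⟩
  rcases eq_or_ne i i₀ with rfl | hi
  · exact tie.ge
  · exact hks ▸ Finset.le_sup' (b s) (Finset.mem_erase.2 ⟨hi, Finset.mem_univ i⟩)

/-- If the largest coefficient of `y = ∑ b i • w i` is attained at both `i₀` and `k`, then a
multiple of `y` can take the place of `w i₀` and `w k`. -/
lemma exists_nonneg_coeff_of_tied_max [AddCommGroup E] [Module ℝ E] {w : ι → E} {b : ι → ℝ}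
    {i₀ k : ι} (tie : b k = b i₀) (hmax : ∀ i, b i ≤ b k) (hpos : 0 < b k) :
    ∃ c : ι → ℝ, (∀ i, 0 ≤ c i) ∧ c k = 0 ∧ c i₀ = 0 ∧
      (b k)⁻¹ • ∑ i, b i • w i + ∑ i, c i • w i = ∑ i, w i := by
  refine ⟨fun j => 1 - b j / b k, fun j => sub_nonneg.2 ((div_le_one hpos).2 (hmax j)),
    by simp [hpos.ne'], by simp [← tie, hpos.ne'], ?_⟩
  simp only [sub_smul, one_smul, Finset.sum_sub_distrib, div_eq_inv_mul, mul_smul,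
    ← Finset.smul_sum, add_sub_cancel]

lemma pos_of_sum_smul_eq_of_max {v : ι → T → ℝ} (hv : ∀ i, 0 ≤ v i) {b : ι → ℝ} {x : T → ℝ}
    (hx : 0 < x) (hsum : ∑ i, b i • v i = x) {k : ι} (hmax : ∀ i, b i ≤ b k) : 0 < b k := by
  by_contra! hneg
  refine hx.not_ge (hsum ▸ Finset.sum_nonpos fun i _ => ?_)
  exact smul_nonpos_of_nonpos_of_nonneg ((hmax i).trans hneg) (hv i)

variable {G : (T → ℝ) → κ → ℝ}

lemma exists_vanishing_family_of_not_linearIndependent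
    (hom : ∀ (c : ℝ) (v : T → ℝ), 0 ≤ c → G (c • v) = c • G v) {v : ι → T → ℝ}
    (hv : ∀ i, 0 ≤ v i) (hdep : ¬LinearIndependent ℝ fun i => (v i, G (v i))) :
    ∃ v' : ι → T → ℝ, (∀ i, 0 ≤ v' i) ∧ (∃ k, v' k = 0) ∧
      ∑ i, (v' i, G (v' i)) = ∑ i, (v i, G (v i)) := by
  obtain ⟨c, c_nonneg, ⟨k, hk⟩, hsum⟩ := exists_nonneg_coeff_of_not_linearIndependent hdep
  refine ⟨fun i => c i • v i, fun i => smul_nonneg (c_nonneg i) (hv i), ⟨k, by simp [hk]⟩, ?_⟩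
  simpa only [hom _ _ (c_nonneg _), Prod.smul_mk] using hsum

/-- The vectors `(v i, G (v i))` form a basis here. Move `v i₀` linearly to `v i₁`: the largest
coordinate of `(x, G x)` in this basis is first attained at `i₀` and finally at `i₁`, hence at some
point at `i₀` and another index simultaneously. -/
lemma exists_vanishing_family_of_basis [Finite T] [Finite κ] (hG : Continuous G)
    (hom : ∀ (c : ℝ) (v : T → ℝ), 0 ≤ c → G (c • v) = c • G v) {v : ι → T → ℝ}
    (hv : ∀ i, 0 ≤ v i) [Nontrivial ι] (B : Module.Basis ι ℝ ((T → ℝ) × (κ → ℝ)))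
    (hB : ∀ i, B i = (v i, G (v i))) :
    ∃ v' : ι → T → ℝ, (∀ i, 0 ≤ v' i) ∧ (∃ k, v' k = 0) ∧
      ∑ i, (v' i, G (v' i)) = ∑ i, (v i, G (v i)) := by
  classical
  obtain ⟨i₀, i₁, h01⟩ := exists_pair_ne ι
  let x : ℝ → T → ℝ := fun s => (1 - s) • v i₀ + s • v i₁
  let b : ℝ → ι → ℝ := fun s => B.equivFun (x s, G (x s))
  have x_cont : Continuous x := by fun_prop
  have b_cont : Continuous b :=
    (LinearMap.continuous_of_finiteDimensional B.equivFun.toLinearMap).comp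
      (x_cont.prodMk (hG.comp x_cont))
  have b_zero : b 0 = Pi.single i₀ 1 := by simp [b, x, ← hB, Finsupp.single_eq_pi_single]
  have b_one : b 1 = Pi.single i₁ 1 := by simp [b, x, ← hB, Finsupp.single_eq_pi_single]
  have repr_eq : ∀ s, ∑ i, b s i • (v i, G (v i)) = (x s, G (x s)) := fun s => by
    simpa only [hB] using B.sum_equivFun (x s, G (x s))
  have single_le : ∀ i j : ι, (Pi.single i 1 : ι → ℝ) j ≤ (Pi.single i 1 : ι → ℝ) i := fun i j => by
    rw [Pi.single_eq_same, Pi.single_apply]; split_ifs <;> norm_num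
  obtain ⟨s, hs, k, hk, tie, hmax⟩ := exists_tied_max (b := b)
    (fun i => (continuous_apply i).comp b_cont) h01.symm
    (b_zero ▸ single_le i₀) (b_one ▸ single_le i₁)
  have v_pos : ∀ i, 0 < v i := fun i => (hv i).lt_of_ne' fun h0 => B.ne_zero i <| by
    have : G 0 = 0 := by simpa using hom 0 0 le_rfl
    rw [hB, h0, this, Prod.mk_zero_zero]
  have x_pos : 0 < x s := by
    rcases hs.2.lt_or_eq with h | rfl
    · exact add_pos_of_pos_of_nonneg (smul_pos (sub_pos.2 h) (v_pos i₀)) (smul_nonneg hs.1 (hv i₁))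
    · simpa [x] using v_pos i₁
  have b_pos : 0 < b s k := pos_of_sum_smul_eq_of_max hv x_pos
    (by simpa [Prod.fst_sum] using congrArg Prod.fst (repr_eq s)) hmax
  obtain ⟨c, c_nonneg, ck, ci₀, hsum⟩ := exists_nonneg_coeff_of_tied_max
    (w := fun i => (v i, G (v i))) tie hmax b_pos
  let v' : ι → T → ℝ := Function.update (fun i => c i • v i) i₀ ((b s k)⁻¹ • x s)
  have graph_eq : ∀ i, (v' i, G (v' i)) =
      Pi.single (M := fun _ => (T → ℝ) × (κ → ℝ)) i₀ ((b s k)⁻¹ • (x s, G (x s))) i +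
        c i • (v i, G (v i)) := fun i => by
    rcases eq_or_ne i i₀ with rfl | hi
    · simp [v', ci₀, hom _ _ (inv_pos.2 b_pos).le]
    · simp [v', hi, hom _ _ (c_nonneg i)]
  refine ⟨v', fun i => ?_, ⟨k, by simp [v', hk, ck]⟩, ?_⟩
  · rcases eq_or_ne i i₀ with rfl | hi
    · simpa [v'] using smul_nonneg (inv_pos.2 b_pos).le x_pos.le
    · simpa [v', hi] using smul_nonneg (c_nonneg i) (hv i)
  · simp only [graph_eq, Finset.sum_add_distrib, Finset.sum_pi_single', Finset.mem_univ, if_true,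
      ← repr_eq s, hsum]

lemma exists_vanishing_family [Fintype T] [Fintype κ] (hG : Continuous G)
    (hom : ∀ (c : ℝ) (v : T → ℝ), 0 ≤ c → G (c • v) = c • G v) {v : ι → T → ℝ}
    (hv : ∀ i, 0 ≤ v i) [Nontrivial ι]
    (hcard : Fintype.card T + Fintype.card κ ≤ Fintype.card ι) :
    ∃ v' : ι → T → ℝ, (∀ i, 0 ≤ v' i) ∧ (∃ k, v' k = 0) ∧
      ∑ i, (v' i, G (v' i)) = ∑ i, (v i, G (v i)) := by
  by_cases hli : LinearIndependent ℝ fun i => (v i, G (v i))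
  · have finrank_eq : Fintype.card ι = Module.finrank ℝ ((T → ℝ) × (κ → ℝ)) :=
      hli.fintype_card_le_finrank.antisymm (by simpa using hcard)
    exact exists_vanishing_family_of_basis hG hom hv
      (basisOfLinearIndependentOfCardEqFinrank hli finrank_eq) fun i => by simp
  · exact exists_vanishing_family_of_not_linearIndependent hom hv hli

/-- Fenchel-Eggleston-Carathéodory theorem for the cone over the graph of a continuous positively
homogeneous function on the nonnegative orthant. -/
lemma exists_small_family [Fintype T] [Fintype κ] (hG : Continuous G)
    (hom : ∀ (c : ℝ) (v : T → ℝ), 0 ≤ c → G (c • v) = c • G v) {k : ℕ} (hk : 1 ≤ k)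
    (hcard : Fintype.card T + Fintype.card κ ≤ k + 1) (m : ℕ) (v : Fin m → T → ℝ)
    (hv : ∀ i, 0 ≤ v i) :
    ∃ m' ≤ k, ∃ v' : Fin m' → T → ℝ, (∀ i, 0 ≤ v' i) ∧
      ∑ i, (v' i, G (v' i)) = ∑ i, (v i, G (v i)) := by
  induction m with
  | zero => exact ⟨0, Nat.zero_le _, v, hv, rfl⟩
  | succ m ih =>
    by_cases hm : m + 1 ≤ k
    · exact ⟨m + 1, hm, v, hv, rfl⟩
    have : Nontrivial (Fin (m + 1)) := Fin.nontrivial_iff_two_le.2 (by omega)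
    obtain ⟨v', v'_nonneg, ⟨j, hj⟩, hsum⟩ := exists_vanishing_family hG hom hv (by simp; omega)
    obtain ⟨m', hm', u, u_nonneg, hu⟩ := ih (fun i => v' (j.succAbove i)) fun i => v'_nonneg _
    have G_zero : G 0 = 0 := by simpa using hom 0 0 le_rfl
    refine ⟨m', hm', u, u_nonneg, ?_⟩
    rw [hu, ← hsum, Fin.sum_univ_succAbove _ j, hj, G_zero, Prod.mk_zero_zero, zero_add]

end ConicReduction

section MassEntropy

variable {α : Type*} [Fintype α]

/-- The entropy of the normalization of a nonnegative vector `y`, times its total mass. It is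
positively homogeneous, which makes conditional entropies sums over the values of the condition. -/
def massEntropy (y : α → ℝ) : ℝ := ∑ a, Real.negMulLog (y a) - Real.negMulLog (∑ a, y a)

lemma continuous_massEntropy : Continuous (massEntropy : (α → ℝ) → ℝ) := by
  unfold massEntropy
  fun_prop

lemma massEntropy_smul (c : ℝ) (y : α → ℝ) : massEntropy (c • y) = c * massEntropy y := by
  simp only [massEntropy, Pi.smul_apply, smul_eq_mul, ← Finset.mul_sum, Real.negMulLog_mul,
    Finset.sum_add_distrib, ← Finset.sum_mul]
  ring

end MassEntropy

section Channel

variable {U T Z α : Type*}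

/-- The joint law of `(U, Z)`, where `Z` has law `p` and `U` is the output of the channel `q` with
input `B Z`. -/
def joint (p : Z → ℝ) (B : Z → T) (q : T → U → ℝ) (ω : U × Z) : ℝ := p ω.2 * q (B ω.2) ω.1

lemma joint_nonneg {p : Z → ℝ} {q : T → U → ℝ} (hp : ∀ z, 0 ≤ p z) (B : Z → T)
    (hq : ∀ t u, 0 ≤ q t u) (ω : U × Z) : 0 ≤ joint p B q ω :=
  mul_nonneg (hp _) (hq _ _)

variable [Fintype Z]

/-- The vector `t ↦ P(U = u, B = t)` under `joint p B q`. -/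
def jointMass (p : Z → ℝ) (B : Z → T) (q : T → U → ℝ) (u : U) (t : T) : ℝ := law p B t * q t u

/-- The contribution to `H(A|U)` of a value of `U` whose vector `t ↦ P(U = u, B = t)` is `v`, if
`U - B - A` is a Markov chain. -/
def condEntContribution [Fintype T] [Fintype α] (p : Z → ℝ) (B : Z → T) (A : Z → α) (v : T → ℝ) :
    ℝ :=
  massEntropy fun a => ∑ t, v t * condLaw p B A t a

variable {p : Z → ℝ} {B : Z → T} {q : T → U → ℝ}

lemma continuous_condEntContribution [Fintype T] [Fintype α] (p : Z → ℝ) (B : Z → T) (A : Z → α) :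
    Continuous (condEntContribution p B A) :=
  continuous_massEntropy.comp (by fun_prop)

lemma condEntContribution_smul [Fintype T] [Fintype α] (p : Z → ℝ) (B : Z → T) (A : Z → α) (c : ℝ)
    (v : T → ℝ) : condEntContribution p B A (c • v) = c * condEntContribution p B A v := by
  rw [condEntContribution, condEntContribution, ← massEntropy_smul]
  congr 1
  ext a
  simp only [Pi.smul_apply, smul_eq_mul, mul_assoc, Finset.mul_sum]

variable [Fintype U]

lemma sum_joint_mul (p : Z → ℝ) (hq : ∀ t, q t ∈ stdSimplex ℝ U) (f : Z → ℝ) :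
    ∑ ω, joint p B q ω * f ω.2 = ∑ z, p z * f z := by
  rw [Fintype.sum_prod_type_right]
  refine Finset.sum_congr rfl fun z _ => ?_
  simp only [joint, mul_right_comm _ _ (f z), ← Finset.mul_sum, (hq _).2, mul_one]

lemma joint_mem_stdSimplex (hp : p ∈ stdSimplex ℝ Z) (B : Z → T)
    (hq : ∀ t, q t ∈ stdSimplex ℝ U) : joint p B q ∈ stdSimplex ℝ (U × Z) :=
  ⟨joint_nonneg hp.1 B fun t => (hq t).1, by
    simpa [hp.2] using sum_joint_mul (B := B) p hq fun _ => 1⟩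

lemma pr_joint_snd (p : Z → ℝ) (hq : ∀ t, q t ∈ stdSimplex ℝ U) (E : Z → Prop) :
    pr (joint p B q) (fun ω => E ω.2) = pr p E := by
  classical
  simpa only [pr, mul_ite, mul_one, mul_zero] using
    sum_joint_mul (B := B) p hq fun z => if E z then 1 else 0

/-- The law of the output `U` under `joint p B q`. -/
def outLaw (p : Z → ℝ) (B : Z → T) (q : T → U → ℝ) (u : U) : ℝ :=
  law (joint p B q) (fun ω => ω.1) u

/-- The joint law of the output `U` and the random variable `A` under `joint p B q`. -/
def pairLaw (p : Z → ℝ) (B : Z → T) (q : T → U → ℝ) (A : Z → α) (u : U) (a : α) : ℝ :=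
  law (joint p B q) (fun ω => (ω.1, A ω.2)) (u, a)

lemma pairLaw_eq_law (p : Z → ℝ) (B : Z → T) (q : T → U → ℝ) (A : Z → α) (u : U) (a : α) :
    pairLaw p B q A u a = law (fun z => p z * q (B z) u) A a := by
  classical
  rw [pairLaw, law, pr, Fintype.sum_prod_type, Finset.sum_eq_single u]
  · simp [joint, law, pr]
  · intro u' _ hu
    simp [hu]
  · simp

lemma sum_pairLaw (p : Z → ℝ) (B : Z → T) (hq : ∀ t, q t ∈ stdSimplex ℝ U) (A : Z → α) (a : α) :
    ∑ u, pairLaw p B q A u a = law p A a := by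
  rw [law, ← pr_joint_snd (B := B) p hq]
  exact sum_law_pair_left (joint p B q) (fun ω => ω.1) (fun ω => A ω.2) a

lemma pairLaw_eq_sum_mul_condLaw [Fintype T] (hp : ∀ z, 0 ≤ p z) (B : Z → T) (q : T → U → ℝ)
    (A : Z → α) (u : U) (a : α) :
    pairLaw p B q A u a = ∑ t, jointMass p B q u t * condLaw p B A t a := by
  classical
  calc pairLaw p B q A u a
      = ∑ t, law p (fun z => (A z, B z)) (a, t) * q t u := by
        simp only [pairLaw_eq_law, law, pr, Finset.sum_mul]
        rw [Finset.sum_comm]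
        refine Finset.sum_congr rfl fun z _ => ?_
        by_cases h : A z = a <;> simp [h]
    _ = ∑ t, jointMass p B q u t * condLaw p B A t a :=
        Finset.sum_congr rfl fun t _ => by rw [jointMass, ← law_mul_condLaw hp]; ring

lemma info_joint [Fintype T] [Fintype α] (hp : ∀ z, 0 ≤ p z) (hq : ∀ t, q t ∈ stdSimplex ℝ U)
    (A : Z → α) :
    info (joint p B q) (fun ω => ω.1) (fun ω => A ω.2) =
      ent p A - ∑ u, condEntContribution p B A (jointMass p B q u) := by
  have contribution : ∀ u, condEntContribution p B A (jointMass p B q u) =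
      ∑ a, Real.negMulLog (pairLaw p B q A u a) - Real.negMulLog (outLaw p B q u) := fun u => by
    have total : ∑ a, pairLaw p B q A u a = outLaw p B q u := by
      simpa only [pairLaw, outLaw, law, Prod.mk.injEq, and_comm] using
        sum_pr_eq_and (joint p B q) (fun ω => A ω.2) fun ω => ω.1 = u
    rw [← total]
    simp only [condEntContribution, massEntropy, pairLaw_eq_sum_mul_condLaw hp]
  have ent_A : ent (joint p B q) (fun ω => A ω.2) = ent p A :=
    Finset.sum_congr rfl fun a _ => congrArg _ (pr_joint_snd p hq fun z => A z = a)
  simp only [contribution, info, ent_A, Finset.sum_sub_distrib]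
  simp only [ent, outLaw, pairLaw, Fintype.sum_prod_type]
  ring

lemma sum_jointMass (p : Z → ℝ) (B : Z → T) (hq : ∀ t, q t ∈ stdSimplex ℝ U) :
    ∑ u, jointMass p B q u = law p B := by
  ext t
  simp only [Finset.sum_apply, jointMass, ← Finset.mul_sum, (hq t).2, mul_one]

lemma exists_channel_of_sum_eq_law [Finite T] (hp : p ∈ stdSimplex ℝ Z) {v : U → T → ℝ}
    (hv : ∀ u, 0 ≤ v u) (hsum : ∑ u, v u = law p B) :
    ∃ q : T → U → ℝ, (∀ t, q t ∈ stdSimplex ℝ U) ∧ jointMass p B q = v := by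
  classical
  cases nonempty_fintype T
  have sum_apply : ∀ t, ∑ u, v u t = law p B t := fun t => by rw [← hsum, Finset.sum_apply]
  have : Nonempty U := by
    by_contra h
    rw [not_nonempty_iff] at h
    simpa [← sum_apply] using (law_mem_stdSimplex hp B).2
  have row : ∀ t, ∃ r ∈ stdSimplex ℝ U, ∀ u, law p B t * r u = v u t := fun t => by
    rcases (law_nonneg hp.1 B t).eq_or_lt with h | h
    · refine ⟨Pi.single (Classical.arbitrary U) 1, single_mem_stdSimplex ℝ _, fun u => ?_⟩
      have v_eq_zero := (Finset.sum_eq_zero_iff_of_nonneg fun u _ => hv u t).1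
        ((sum_apply t).trans h.symm) u (Finset.mem_univ u)
      rw [← h, zero_mul, v_eq_zero]
    · exact ⟨fun u => v u t / law p B t, ⟨fun u => div_nonneg (hv u t) h.le, by
        rw [← Finset.sum_div, sum_apply, div_self h.ne']⟩, fun u => mul_div_cancel₀ _ h.ne'⟩
  choose q q_mem hq using row
  exact ⟨q, q_mem, funext fun u => funext fun t => hq t u⟩

lemma exists_small_alphabet [Fintype T] {κ : Type*} [Fintype κ] (hp : p ∈ stdSimplex ℝ Z)
    (B : Z → T) {φ : κ → (T → ℝ) → ℝ} (hφ : ∀ j, Continuous (φ j))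
    (hom : ∀ j (c : ℝ) (v : T → ℝ), φ j (c • v) = c * φ j v) {k : ℕ} (hk : 1 ≤ k)
    (hcard : Fintype.card T + Fintype.card κ ≤ k + 1) {m : ℕ} (Q : T → PMF (Fin m)) :
    ∃ m' ≤ k, ∃ Q' : T → PMF (Fin m'), ∀ j,
      ∑ u, φ j (jointMass p B (fun t => wt (Q' t)) u) =
        ∑ u, φ j (jointMass p B (fun t => wt (Q t)) u) := by
  obtain ⟨m', hm', v, v_nonneg, hv⟩ := exists_small_family (G := fun v j => φ j v)
    (continuous_pi hφ) (fun c v _ => funext fun j => hom j c v) hk hcard m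
    (jointMass p B fun t => wt (Q t))
    fun u t => mul_nonneg (law_nonneg hp.1 _ t) ((wt_mem_stdSimplex _).1 _)
  have mass_eq := congrArg Prod.fst hv
  have value_eq := congrArg Prod.snd hv
  simp only [Prod.fst_sum, Prod.snd_sum] at mass_eq value_eq
  obtain ⟨q, q_mem, rfl⟩ := exists_channel_of_sum_eq_law hp v_nonneg
    (mass_eq.trans (sum_jointMass p B fun t => wt_mem_stdSimplex (Q t)))
  refine ⟨m', hm', fun t => ofStdSimplex (q t) (q_mem t), fun j => ?_⟩
  simpa only [wt_ofStdSimplex, Finset.sum_apply] using congrFun value_eq j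

end Channel

section Regions

lemma iUnion_channels_eq {Xt : Type*} {C : ∀ {m : ℕ}, (Xt → PMF (Fin m)) → Prop}
    {R : ∀ {m : ℕ}, (Xt → PMF (Fin m)) → Set (ℝ × ℝ × ℝ)} (k : ℕ)
    (h : ∀ (m : ℕ) (Q : Xt → PMF (Fin m)), C Q → ∃ m' ≤ k, ∃ Q' : Xt → PMF (Fin m'),
      C Q' ∧ R Q' = R Q) :
    (⋃ (m : ℕ) (_ : (m : ℕ∞) ≤ ⊤) (Q : Xt → PMF (Fin m)) (_ : C Q), R Q)
      = ⋃ (m : ℕ) (_ : (m : ℕ∞) ≤ k) (Q : Xt → PMF (Fin m)) (_ : C Q), R Q := by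
  ext r
  simp only [Set.mem_iUnion, exists_prop]
  constructor
  · rintro ⟨m, -, Q, hC, hr⟩
    obtain ⟨m', hm', Q', hC', hR⟩ := h m Q hC
    exact ⟨m', by exact_mod_cast hm', Q', hC', hR ▸ hr⟩
  · rintro ⟨m, -, Q, hC, hr⟩
    exact ⟨m, le_top, Q, hC, hr⟩

variable {X Xt Y : Type*} (PX : PMF X) (BC : X → PMF (Xt × Y))

lemma wt_auxLaw {m : ℕ} (Q : Xt → PMF (Fin m)) :
    wt (auxLaw PX BC Q) =
      joint (wt (sourceLaw PX BC)) (fun z => z.2.1) fun t => wt (Q t) := by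
  ext ⟨u, z⟩
  exact wt_bind_map (sourceLaw PX BC) (fun z => Q z.2.1) (e := fun z u => (u, z))
    (fun _ _ _ _ h => (Prod.mk.inj h).symm) z u

variable [Fintype X] [Fintype Xt] [Fintype Y]

lemma info_joint_eq_mutualInfo {α : Type*} [Fintype α] {m : ℕ} (Q : Xt → PMF (Fin m))
    (A : X × Xt × Y → α) :
    info (joint (wt (sourceLaw PX BC)) (fun z => z.2.1) fun t => wt (Q t)) (fun ω => ω.1)
      (fun ω => A ω.2) = mutualInfo (auxLaw PX BC Q) (fun ω => ω.1) fun ω => A ω.2 := by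
  rw [mutualInfo_eq_info, wt_auxLaw]

lemma mutualInfo_auxLaw {α : Type*} [Fintype α] {m : ℕ} (Q : Xt → PMF (Fin m))
    (A : X × Xt × Y → α) :
    mutualInfo (auxLaw PX BC Q) (fun ω => ω.1) (fun ω => A ω.2) =
      ent (wt (sourceLaw PX BC)) A -
        ∑ u, condEntContribution (wt (sourceLaw PX BC)) (fun z => z.2.1) A
          (jointMass (wt (sourceLaw PX BC)) (fun z => z.2.1) (fun t => wt (Q t)) u) := by
  rw [← info_joint_eq_mutualInfo, info_joint (wt_mem_stdSimplex _).1 fun t => wt_mem_stdSimplex _]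

lemma exists_alphabet_preserving_info {m : ℕ} (Q : Xt → PMF (Fin m)) :
    ∃ m' ≤ Fintype.card Xt + 2, ∃ Q' : Xt → PMF (Fin m'),
      infoUX PX BC Q' = infoUX PX BC Q ∧ infoUY PX BC Q' = infoUY PX BC Q ∧
        infoUXt PX BC Q' = infoUXt PX BC Q := by
  obtain ⟨m', hm', Q', h⟩ := exists_small_alphabet (wt_mem_stdSimplex (sourceLaw PX BC))
    (fun z => z.2.1)
    (φ := ![condEntContribution (wt (sourceLaw PX BC)) (fun z => z.2.1) fun z => z.1,
      condEntContribution (wt (sourceLaw PX BC)) (fun z => z.2.1) fun z => z.2.2,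
      condEntContribution (wt (sourceLaw PX BC)) (fun z => z.2.1) fun z => z.2.1])
    (fun j => by fin_cases j <;> exact continuous_condEntContribution _ _ _)
    (fun j => by fin_cases j <;> exact condEntContribution_smul _ _ _)
    (k := Fintype.card Xt + 2) (by omega) (by simp) Q
  refine ⟨m', hm', Q', ?_, ?_, ?_⟩
  · simpa only [infoUX, mutualInfo_auxLaw PX BC _ fun z => z.1, Matrix.cons_val]
      using congrArg (_ - ·) (h 0)
  · simpa only [infoUY, mutualInfo_auxLaw PX BC _ fun z => z.2.2, Matrix.cons_val]
      using congrArg (_ - ·) (h 1)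
  · simpa only [infoUXt, mutualInfo_auxLaw PX BC _ fun z => z.2.1, Matrix.cons_val]
      using congrArg (_ - ·) (h 2)

lemma exists_alphabet_preserving_key_storage {m : ℕ} (Q : Xt → PMF (Fin m)) :
    ∃ m' ≤ Fintype.card Xt + 1, ∃ Q' : Xt → PMF (Fin m'),
      infoUY PX BC Q' = infoUY PX BC Q ∧ infoUXt PX BC Q' = infoUXt PX BC Q := by
  obtain ⟨m', hm', Q', h⟩ := exists_small_alphabet (wt_mem_stdSimplex (sourceLaw PX BC))
    (fun z => z.2.1)
    (φ := ![condEntContribution (wt (sourceLaw PX BC)) (fun z => z.2.1) fun z => z.2.2,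
      condEntContribution (wt (sourceLaw PX BC)) (fun z => z.2.1) fun z => z.2.1])
    (fun j => by fin_cases j <;> exact continuous_condEntContribution _ _ _)
    (fun j => by fin_cases j <;> exact condEntContribution_smul _ _ _)
    (k := Fintype.card Xt + 1) (by omega) (by simp) Q
  refine ⟨m', hm', Q', ?_, ?_⟩
  · simpa only [infoUY, mutualInfo_auxLaw PX BC _ fun z => z.2.2, Matrix.cons_val]
      using congrArg (_ - ·) (h 0)
  · simpa only [infoUXt, mutualInfo_auxLaw PX BC _ fun z => z.2.1, Matrix.cons_val]
      using congrArg (_ - ·) (h 1)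

/-- The channels `Q` and `Q'` contribute the same tuples to the same parts of both regions. -/
def SameRates {m m' : ℕ} (Q : Xt → PMF (Fin m)) (Q' : Xt → PMF (Fin m')) : Prop :=
  max 0 (infoUX PX BC Q - infoUY PX BC Q) = max 0 (infoUX PX BC Q' - infoUY PX BC Q') ∧
    ratesGS PX BC Q = ratesGS PX BC Q' ∧ ratesCS PX BC Q = ratesCS PX BC Q'

/-- An alphabet of at most `k` letters attains everything that the channels with arbitrary alphabets
attain. -/
def AlphabetSuffices (k : ℕ) : Prop :=
  ∀ (m : ℕ) (Q : Xt → PMF (Fin m)), ∃ m' ≤ k, ∃ Q' : Xt → PMF (Fin m'), SameRates PX BC Q Q'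

lemma alphabetSuffices_card_add_two : AlphabetSuffices PX BC (Fintype.card Xt + 2) := by
  intro m Q
  obtain ⟨m', hm', Q', hX, hY, hXt⟩ := exists_alphabet_preserving_info PX BC Q
  exact ⟨m', hm', Q', by simp only [SameRates, ratesGS, ratesCS, hX, hY, hXt, and_self]⟩

lemma alphabetSuffices_card_add_one
    (h : ∀ (m : ℕ) (Q : Xt → PMF (Fin m)), infoUX PX BC Q ≤ infoUY PX BC Q) :
    AlphabetSuffices PX BC (Fintype.card Xt + 1) := by
  intro m Q
  obtain ⟨m', hm', Q', hY, hXt⟩ := exists_alphabet_preserving_key_storage PX BC Q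
  have leak_eq : max 0 (infoUX PX BC Q - infoUY PX BC Q) =
      max 0 (infoUX PX BC Q' - infoUY PX BC Q') := by
    rw [max_eq_left (sub_nonpos.2 (h m Q)), max_eq_left (sub_nonpos.2 (h m' Q'))]
  refine ⟨m', hm', Q', leak_eq, ?_, ?_⟩
  · rw [ratesGS, ratesGS, leak_eq, hY, hXt]
  · rw [ratesCS, ratesCS, leak_eq, hY, hXt]

namespace AlphabetSuffices

variable {PX BC} {k : ℕ}

lemma region1_eq (h : AlphabetSuffices PX BC k) : region1 PX BC ⊤ = region1 PX BC k :=
  iUnion_channels_eq k fun m Q hC => by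
    obtain ⟨m', hm', Q', leak, gs, -⟩ := h m Q
    exact ⟨m', hm', Q', leak ▸ hC, gs.symm⟩

lemma region2_eq (h : AlphabetSuffices PX BC k) : region2 PX BC ⊤ = region2 PX BC k :=
  iUnion_channels_eq k fun m Q hC => by
    obtain ⟨m', hm', Q', leak, gs, -⟩ := h m Q
    exact ⟨m', hm', Q', leak ▸ hC, gs.symm⟩

lemma region3_eq (h : AlphabetSuffices PX BC k) : region3 PX BC ⊤ = region3 PX BC k :=
  iUnion_channels_eq k fun m Q hC => by
    obtain ⟨m', hm', Q', leak, -, cs⟩ := h m Q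
    exact ⟨m', hm', Q', leak ▸ hC, cs.symm⟩

lemma region4_eq (h : AlphabetSuffices PX BC k) : region4 PX BC ⊤ = region4 PX BC k :=
  iUnion_channels_eq k fun m Q hC => by
    obtain ⟨m', hm', Q', leak, -, cs⟩ := h m Q
    exact ⟨m', hm', Q', leak ▸ hC, cs.symm⟩

end AlphabetSuffices

end Regions

section Hashing

variable {Ω σ ζ κ H : Type*} [Fintype σ] [Fintype H] {μ : H → ℝ} {h : H → κ → σ}

/-- A random function `h`, with random seed of law `μ`, under which distinct points collide with
probability at most `1 / |σ|`. -/
def IsUniversal (μ : H → ℝ) (h : H → κ → σ) : Prop :=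
  ∀ k k', k ≠ k' → pr μ (fun i => h i k = h i k') ≤ 1 / Fintype.card σ

section Functions

variable [Fintype κ] [DecidableEq κ] [Nonempty σ]

lemma const_inv_card_mem_stdSimplex (κ : Type*) [Fintype κ] [Nonempty κ] :
    (fun _ => (Fintype.card κ : ℝ)⁻¹) ∈ stdSimplex ℝ κ :=
  ⟨fun _ => by positivity, by simp⟩

lemma isUniversal_functions :
    IsUniversal (fun _ => (Fintype.card (κ → σ) : ℝ)⁻¹) fun h : κ → σ => h := by
  classical
  intro k k' hk
  have collisions : ∑ h : κ → σ, (if h k = h k' then (1 : ℝ) else 0) =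
      Fintype.card ({j // j ≠ k} → σ) := by
    rw [← (Equiv.funSplitAt k σ).symm.sum_comp, Fintype.sum_prod_type_right]
    simp [Equiv.funSplitAt, Equiv.piSplitAt, hk.symm]
  have card_eq : (Fintype.card (κ → σ) : ℝ) =
      Fintype.card σ * Fintype.card ({j // j ≠ k} → σ) := by
    rw [Fintype.card_congr (Equiv.funSplitAt k σ), Fintype.card_prod, Nat.cast_mul]
  have card_ne_zero : (Fintype.card ({j // j ≠ k} → σ) : ℝ) ≠ 0 :=
    Nat.cast_ne_zero.2 Fintype.card_ne_zero
  calc pr (fun _ => (Fintype.card (κ → σ) : ℝ)⁻¹) (fun h : κ → σ => h k = h k')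
      = (∑ h : κ → σ, if h k = h k' then (1 : ℝ) else 0) * (Fintype.card (κ → σ) : ℝ)⁻¹ := by
        simp only [pr, Finset.sum_mul, ite_mul, one_mul, zero_mul]
    _ ≤ 1 / Fintype.card σ := by
        rw [collisions, card_eq]
        refine le_of_eq ?_
        field_simp

end Functions

variable [Fintype Ω] {p : Ω → ℝ}

lemma deficit_eq_sum_mul_log [Fintype ζ] (hp : p ∈ stdSimplex ℝ Ω) (S : Ω → σ) (Z : Ω → ζ) :
    deficit p S Z = ∑ ω, p ω * Real.log (Fintype.card σ * condLaw p Z S (Z ω) (S ω)) := by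
  have : Nonempty σ := (nonempty_of_mem_stdSimplex hp).map S
  have card_pos : (0 : ℝ) < Fintype.card σ := Nat.cast_pos.2 Fintype.card_pos
  have log_split : ∀ ω, 0 < p ω → Real.log (Fintype.card σ * condLaw p Z S (Z ω) (S ω)) =
      Real.log (Fintype.card σ) + (Real.log (law p (fun ω => (S ω, Z ω)) (S ω, Z ω)) -
        Real.log (law p Z (Z ω))) := fun ω h0 => by
    rw [Real.log_mul card_pos.ne' (condLaw_pos hp.1 Z S h0).ne', condLaw, Real.log_div
      (law_pos hp.1 (fun ω => (S ω, Z ω)) h0).ne' (law_pos hp.1 Z h0).ne']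
  rw [sum_mul_congr_of_pos hp.1 log_split]
  simp only [mul_add, mul_sub, Finset.sum_add_distrib, Finset.sum_sub_distrib, sum_mul_const hp,
    deficit, ent_eq_sum]
  ring

lemma sum_mul_law_hash_le (hμ : μ ∈ stdSimplex ℝ H) (hu : IsUniversal μ h) (hp : ∀ ω, 0 ≤ p ω)
    (K : Ω → κ) (Z : Ω → ζ) (k : κ) (z : ζ) :
    ∑ i, μ i * law p (fun ω => (h i (K ω), Z ω)) (h i k, z) ≤
      law p (fun ω => (K ω, Z ω)) (k, z) + law p Z z * (1 / Fintype.card σ) := by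
  classical
  simp only [law]
  rw [sum_mul_pr_comm, pr, pr, Finset.sum_mul, ← Finset.sum_add_distrib]
  refine Finset.sum_le_sum fun ω _ => ?_
  by_cases hZ : Z ω = z
  · by_cases hK : K ω = k
    · have : p ω * pr μ (fun i => (h i (K ω), Z ω) = (h i k, z)) ≤ p ω :=
        mul_le_of_le_one_right (hp ω) (pr_le_one hμ _)
      simp only [hZ, hK, if_true] at this ⊢
      exact this.trans (le_add_of_nonneg_right (mul_nonneg (hp ω) (by positivity)))
    · simpa [hZ, hK] using mul_le_mul_of_nonneg_left (hu _ _ hK) (hp ω)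
  · simp [hZ, pr]

lemma sum_mul_condLaw_hash_le (hμ : μ ∈ stdSimplex ℝ H) (hu : IsUniversal μ h)
    (hp : ∀ ω, 0 ≤ p ω) (K : Ω → κ) (Z : Ω → ζ) (k : κ) {z : ζ} (hz : 0 < law p Z z) :
    ∑ i, μ i * condLaw p Z (fun ω => h i (K ω)) z (h i k) ≤
      condLaw p Z K z k + 1 / Fintype.card σ := by
  simp only [condLaw, ← mul_div_assoc, ← Finset.sum_div]
  rw [div_le_iff₀ hz, add_mul, div_mul_cancel₀ _ hz.ne', mul_comm (1 / _)]
  exact sum_mul_law_hash_le hμ hu hp K Z k z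

/-- The leftover hash lemma for relative entropy: Jensen's inequality moves the average over the
seed inside the logarithm, where it only sees collision probabilities. -/
lemma sum_mul_deficit_hash_le [Fintype ζ] (hμ : μ ∈ stdSimplex ℝ H) (hu : IsUniversal μ h)
    (hp : p ∈ stdSimplex ℝ Ω) (K : Ω → κ) (Z : Ω → ζ) :
    ∑ i, μ i * deficit p (fun ω => h i (K ω)) Z ≤
      ∑ ω, p ω * Real.log (1 + Fintype.card σ * condLaw p Z K (Z ω) (K ω)) := by
  obtain ⟨i₀⟩ := nonempty_of_mem_stdSimplex hμ
  have : Nonempty σ := (nonempty_of_mem_stdSimplex hp).map fun ω => h i₀ (K ω)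
  have card_pos : (0 : ℝ) < Fintype.card σ := Nat.cast_pos.2 Fintype.card_pos
  simp only [deficit_eq_sum_mul_log hp, Finset.mul_sum, mul_left_comm (μ _)]
  rw [Finset.sum_comm]
  simp only [← Finset.mul_sum]
  refine sum_mul_le_of_pos hp.1 fun ω h0 => ?_
  refine sum_mul_log_le_log hμ
    (fun i _ => mul_pos card_pos (condLaw_pos hp.1 Z (fun ω => h i (K ω)) h0))
    (add_pos_of_pos_of_nonneg one_pos (mul_nonneg card_pos.le (condLaw_nonneg hp.1 _ _ _ _))) ?_
  calc ∑ i, μ i * (Fintype.card σ * condLaw p Z (fun ω => h i (K ω)) (Z ω) (h i (K ω)))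
      = Fintype.card σ * ∑ i, μ i * condLaw p Z (fun ω => h i (K ω)) (Z ω) (h i (K ω)) := by
        simp only [mul_left_comm (μ _), Finset.mul_sum]
    _ ≤ Fintype.card σ * (condLaw p Z K (Z ω) (K ω) + 1 / Fintype.card σ) :=
        mul_le_mul_of_nonneg_left
          (sum_mul_condLaw_hash_le hμ hu hp.1 K Z _ (law_pos hp.1 Z h0)) card_pos.le
    _ = 1 + Fintype.card σ * condLaw p Z K (Z ω) (K ω) := by
        field_simp
        ring

lemma sum_mul_log_one_add_le (hp : p ∈ stdSimplex ℝ Ω) {f : Ω → ℝ} (hf : ∀ ω, 0 ≤ f ω)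
    (hf_one : ∀ ω, f ω ≤ 1) {N g : ℝ} (hN : 0 ≤ N) (hg : 0 ≤ g) {E : Ω → Prop}
    (hE : ∀ ω, E ω → f ω ≤ g) :
    ∑ ω, p ω * Real.log (1 + N * f ω) ≤
      Real.log (1 + N * g) + pr p (fun ω => ¬E ω) * Real.log (1 + N) := by
  classical
  have log_mono : ∀ ω {c : ℝ}, f ω ≤ c → Real.log (1 + N * f ω) ≤ Real.log (1 + N * c) :=
    fun ω c hc => Real.log_le_log (by have := hf ω; positivity) (by gcongr)
  rw [← sum_mul_const hp (Real.log (1 + N * g)), pr, Finset.sum_mul, ← Finset.sum_add_distrib]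
  refine Finset.sum_le_sum fun ω _ => ?_
  by_cases hω : E ω
  · simpa [hω] using mul_le_mul_of_nonneg_left (log_mono ω (hE ω hω)) (hp.1 ω)
  · have le_log := mul_le_mul_of_nonneg_left (log_mono ω (hf_one ω)) (hp.1 ω)
    have log_nonneg : 0 ≤ Real.log (1 + N * g) :=
      Real.log_nonneg (le_add_of_nonneg_right (mul_nonneg hN hg))
    simp only [mul_one] at le_log
    simpa [hω] using le_log.trans (le_add_of_nonneg_left (mul_nonneg (hp.1 ω) log_nonneg))

lemma sum_mul_deficit_hash_le_of_condLaw_le [Fintype ζ] (hμ : μ ∈ stdSimplex ℝ H)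
    (hu : IsUniversal μ h) (hp : p ∈ stdSimplex ℝ Ω) (K : Ω → κ) (Z : Ω → ζ) {g : ℝ} (hg : 0 ≤ g)
    {E : Ω → Prop} (hE : ∀ ω, E ω → condLaw p Z K (Z ω) (K ω) ≤ g) :
    ∑ i, μ i * deficit p (fun ω => h i (K ω)) Z ≤ Real.log (1 + Fintype.card σ * g) +
      pr p (fun ω => ¬E ω) * Real.log (1 + Fintype.card σ) :=
  (sum_mul_deficit_hash_le hμ hu hp K Z).trans (sum_mul_log_one_add_le hp
    (fun _ => condLaw_nonneg hp.1 _ _ _ _) (fun _ => condLaw_le_one hp.1 _ _ _ _)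
    (Nat.cast_nonneg _) hg hE)

end Hashing

section Covering

variable {U T Z ι : Type*}

lemma one_sub_pow_le {a s : ℝ} (ha : 0 ≤ a) (ha_one : a ≤ 1) {M : ℕ} {x : ℝ} (hx : 0 ≤ x)
    (hx_le : x ≤ 1 - a * s) : x ^ M ≤ 1 - a + Real.exp (-(M * s)) := by
  have pow_le : x ^ M ≤ Real.exp (-(a * s)) ^ M :=
    pow_le_pow_left₀ hx (hx_le.trans (by linarith [Real.add_one_le_exp (-(a * s))])) M
  have exp_eq : Real.exp (-(a * s)) ^ M = Real.exp ((1 - a) • 0 + a • (-(M * s))) := by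
    rw [← Real.exp_nat_mul]
    simp only [smul_eq_mul, mul_zero, zero_add]
    ring_nf
  have convex := convexOn_exp.2 (Set.mem_univ 0) (Set.mem_univ (-(M * s))) (sub_nonneg.2 ha_one) ha
    (by ring)
  have smul_le : a • Real.exp (-(M * s)) ≤ Real.exp (-(M * s)) :=
    mul_le_of_le_one_left (Real.exp_pos _).le ha_one
  rw [Real.exp_zero, smul_eq_mul (1 - a) (1 : ℝ), mul_one] at convex
  linarith

lemma pr_not_pow_le [Fintype U] {P Q : U → ℝ} (hP : P ∈ stdSimplex ℝ U) (hQ : Q ∈ stdSimplex ℝ U)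
    {E : U → Prop} {α : ℝ} (hα : 0 < α) (h : ∀ u, E u → Q u ≤ α * P u) (M : ℕ) :
    pr P (fun u => ¬E u) ^ M ≤ pr Q (fun u => ¬E u) + Real.exp (-(M / α)) := by
  have pr_le : pr Q E ≤ α * pr P E := by
    rw [pr, pr, Finset.mul_sum]
    refine Finset.sum_le_sum fun u _ => ?_
    by_cases hu : E u <;> simp [hu, h u]
  rw [pr_not hQ, div_eq_mul_inv]
  refine one_sub_pow_le (pr_nonneg hQ.1 E) (pr_le_one hQ E) (pr_nonneg hP.1 _) ?_
  rw [pr_not hP, ← div_eq_mul_inv]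
  linarith [(div_le_iff₀' hα).2 pr_le]

variable [Fintype U] [Fintype Z] [Fintype ι] [DecidableEq ι] {p : Z → ℝ} {B : Z → T}
  {q : T → U → ℝ}

lemma outLaw_mem_stdSimplex (hp : p ∈ stdSimplex ℝ Z) (B : Z → T)
    (hq : ∀ t, q t ∈ stdSimplex ℝ U) : outLaw p B q ∈ stdSimplex ℝ U :=
  law_mem_stdSimplex (joint_mem_stdSimplex hp B hq) _

lemma pr_joint (p : Z → ℝ) (B : Z → T) (q : T → U → ℝ) (E : U → Z → Prop) :
    pr (joint p B q) (fun ω => E ω.1 ω.2) = ∑ z, p z * pr (q (B z)) fun u => E u z := by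
  classical
  simp only [pr, Fintype.sum_prod_type_right, joint, Finset.mul_sum, mul_ite, mul_zero]

/-- The covering lemma: all but the last term is the probability that the channel output does not
describe its input. -/
lemma sum_prodWeight_mul_pr_uncovered_le (hp : p ∈ stdSimplex ℝ Z)
    (hq : ∀ t, q t ∈ stdSimplex ℝ U) {R : U → T → Prop} {α : ℝ} (hα : 0 < α)
    (hR : ∀ u t, R u t → q t u ≤ α * outLaw p B q u) :
    ∑ c : ι → U, prodWeight ι (outLaw p B q) c * pr p (fun z => ∀ j, ¬R (c j) (B z)) ≤
      pr (joint p B q) (fun ω => ¬R ω.1 (B ω.2)) + Real.exp (-(Fintype.card ι / α)) := by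
  rw [sum_mul_pr_comm, pr_joint p B q fun u z => ¬R u (B z), ← sum_mul_const hp (Real.exp _),
    ← Finset.sum_add_distrib]
  simp only [← mul_add]
  refine sum_mul_le_of_pos hp.1 fun z _ => ?_
  have uncovered : pr (prodWeight ι (outLaw p B q)) (fun c => ∀ j, ¬R (c j) (B z)) = _ :=
    pr_prod_forall (fun _ => outLaw p B q) fun _ u => ¬R u (B z)
  rw [uncovered, Finset.prod_const, Finset.card_univ]
  exact pr_not_pow_le (outLaw_mem_stdSimplex hp B hq) (hq (B z)) hα (fun u => hR u (B z)) _

end Covering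

section Quantization

variable {U T Z ι δ : Type*} [Fintype Z] {p : Z → ℝ} {B : Z → T} {q : T → U → ℝ}
  {good : U → Z → Prop} {γ : ℝ} {R : U → T → Prop} {c : ι → U}

/-- The conditional probability, given `B = t`, that `good u` fails is less than `γ`, and
`P(B = t) > 0`. -/
def Admissible (p : Z → ℝ) (B : Z → T) (good : U → Z → Prop) (γ : ℝ) (u : U) (t : T) : Prop :=
  pr p (fun z => B z = t ∧ ¬good u z) < γ * law p B t

lemma Admissible.of_good (hp : ∀ z, 0 ≤ p z) (hγ : γ ≤ 1) {u : U} {t : T}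
    (h : Admissible p B good γ u t) (hgood : ∀ u z, good u z → R u (B z)) : R u t := by
  by_contra hR
  have hbad : ∀ z, B z = t → ¬good u z := fun z hz hz' => hR (hz ▸ hgood u z hz')
  have : law p B t = pr p fun z => B z = t ∧ ¬good u z :=
    pr_congr fun z => (and_iff_left_of_imp fun hz => hbad z hz).symm
  rw [Admissible, ← this] at h
  linarith [mul_le_mul_of_nonneg_right hγ (law_nonneg hp B t)]

lemma pr_joint_eq_sum_pr_and [Fintype U] [Fintype T] (p : Z → ℝ) (B : Z → T) (q : T → U → ℝ)
    (E : U → Z → Prop) : pr (joint p B q) (fun ω => E ω.1 ω.2) =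
      ∑ u, ∑ t, q t u * pr p fun z => B z = t ∧ E u z := by
  classical
  simp only [pr, Fintype.sum_prod_type, joint, Finset.mul_sum, mul_ite, mul_zero]
  refine Finset.sum_congr rfl fun u _ => ?_
  rw [Finset.sum_comm]
  refine Finset.sum_congr rfl fun z _ => ?_
  simp [ite_and, mul_comm]

lemma pr_not_admissible_le [Fintype U] [Finite T] (hp : ∀ z, 0 ≤ p z)
    (hq : ∀ t, q t ∈ stdSimplex ℝ U) (hγ : 0 < γ) :
    pr (joint p B q) (fun ω => ¬Admissible p B good γ ω.1 (B ω.2)) ≤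
      pr (joint p B q) (fun ω => ¬good ω.1 ω.2) / γ := by
  cases nonempty_fintype T
  rw [le_div_iff₀' hγ, pr_joint_eq_sum_pr_and p B q fun u z => ¬good u z,
    pr_joint_eq_sum_pr_and p B q fun u z => ¬Admissible p B good γ u (B z), Finset.mul_sum]
  simp only [Finset.mul_sum, mul_left_comm γ]
  refine Finset.sum_le_sum fun u _ => Finset.sum_le_sum fun t _ =>
    mul_le_mul_of_nonneg_left ?_ ((hq t).1 u)
  by_cases h : Admissible p B good γ u t
  · rw [pr_eq_zero fun z hz => hz.2 (hz.1 ▸ h), mul_zero]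
    exact pr_nonneg hp _
  · exact (mul_le_mul_of_nonneg_left (pr_mono hp fun z _ hz => hz.1) hγ.le).trans (not_lt.1 h)

open Classical in
/-- The quantizer with codebook `c` picks the index of a codeword that is `R`-related to the
source, if there is one. -/
def quantize (R : U → T → Prop) (c : ι → U) (t : T) : Option ι :=
  if h : ∃ j, R (c j) t then some h.choose else none

lemma rel_of_quantize_eq_some {t : T} {j : ι} (h : quantize R c t = some j) : R (c j) t := by
  unfold quantize at h
  split_ifs at h with h'
  rw [← Option.some.inj h]
  exact h'.choose_spec

lemma quantize_eq_none {t : T} : quantize R c t = none ↔ ∀ j, ¬R (c j) t := by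
  unfold quantize
  split_ifs with h
  · simpa using h
  · simpa using h

lemma outLaw_mul_law_quantize_le [Fintype U] (hp : ∀ z, 0 ≤ p z) (hq : ∀ t u, 0 ≤ q t u) {α : ℝ}
    (hα : 0 < α) (hR : ∀ u t, R u t → α * outLaw p B q u ≤ q t u) (c : ι → U) (D : Z → δ) (j : ι)
    (d : δ) : outLaw p B q (c j) * law p (fun z => (quantize R c (B z), D z)) (some j, d) ≤
      pairLaw p B q D (c j) d / α := by
  classical
  rw [le_div_iff₀ hα, pairLaw_eq_law, law, law, pr, pr, Finset.mul_sum, Finset.sum_mul]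
  refine Finset.sum_le_sum fun z _ => ?_
  by_cases hd : D z = d
  · by_cases hk : quantize R c (B z) = some j
    · have := mul_le_mul_of_nonneg_left (hR _ _ (rel_of_quantize_eq_some hk)) (hp z)
      simp only [hd, hk, if_true]
      linarith
    · simpa [hd, hk] using mul_nonneg (hp z) (hq _ _)
  · simp [hd]

/-- The source is quantized, and the chosen codeword is good for the outcome. -/
def Success (B : Z → T) (good : U → Z → Prop) (R : U → T → Prop) (c : ι → U) (z : Z) : Prop :=
  ∃ j, quantize R c (B z) = some j ∧ good (c j) z

lemma pr_not_success_le [Finite T] (hp : p ∈ stdSimplex ℝ Z) (hγ : 0 ≤ γ) (c : ι → U) :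
    pr p (fun z => ¬Success B good (Admissible p B good γ) c z) ≤
      pr p (fun z => ∀ j, ¬Admissible p B good γ (c j) (B z)) + γ := by
  cases nonempty_fintype T
  set R := Admissible p B good γ
  have pr_quantized : ∀ t, pr p (fun z => B z = t ∧ ∃ j, quantize R c (B z) = some j ∧
      ¬good (c j) z) ≤ law p B t * γ := fun t => by
    cases hk : quantize R c t with
    | none =>
      rw [pr_eq_zero]
      · exact mul_nonneg (law_nonneg hp.1 B t) hγ
      · rintro z ⟨rfl, j, hj, -⟩
        exact absurd (hk.symm.trans hj) (Option.some_ne_none j).symm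
    | some j =>
      have admissible : Admissible p B good γ (c j) t := rel_of_quantize_eq_some hk
      rw [mul_comm]
      refine (pr_mono hp.1 fun z _ hz => ?_).trans admissible.le
      obtain ⟨rfl, j', hj', hbad⟩ := hz
      exact ⟨rfl, Option.some.inj (hk.symm.trans hj') ▸ hbad⟩
  have pr_bad : pr p (fun z => ∃ j, quantize R c (B z) = some j ∧ ¬good (c j) z) ≤ γ := by
    rw [← sum_pr_eq_and p B]
    refine (Finset.sum_le_sum fun t _ => pr_quantized t).trans_eq ?_
    exact sum_mul_const (law_mem_stdSimplex hp B) γ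
  refine (pr_mono hp.1 fun z _ hz => ?_).trans
    ((pr_or_le hp.1 _ _).trans (add_le_add le_rfl pr_bad))
  cases hk : quantize R c (B z) with
  | none => exact Or.inl (quantize_eq_none.1 hk)
  | some j => exact Or.inr ⟨j, rfl, fun hg => hz ⟨j, hk, hg⟩⟩

end Quantization

section Binning

variable {Z κ σ Y H : Type*}

/-- The decoder picks an element `k` of the bin `w` that fits the observation `y`, arbitrarily if
there are several ones or none. -/
def binDecode [Nonempty κ] (F : κ → Y → Prop) (b : κ → σ) (w : σ) (y : Y) : κ :=
  Classical.epsilon fun k => b k = w ∧ F k y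

variable [Fintype Z] [Fintype κ] [Nonempty κ] {p : Z → ℝ}

lemma pr_binDecode_ne_le (hp : ∀ z, 0 ≤ p z) (K : Z → κ) (C : Z → Y) (F : κ → Y → Prop)
    (b : κ → σ) : pr p (fun z => binDecode F b (b (K z)) (C z) ≠ K z) ≤
      pr p (fun z => ¬F (K z) (C z)) +
        ∑ k, pr p fun z => (k ≠ K z ∧ F k (C z)) ∧ b k = b (K z) := by
  refine (pr_mono hp fun z _ hz => ?_).trans ((pr_or_le hp _ _).trans
    (add_le_add le_rfl (pr_exists_le hp fun k z => (k ≠ K z ∧ F k (C z)) ∧ b k = b (K z))))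
  by_cases hF : F (K z) (C z)
  · have spec := Classical.epsilon_spec (p := fun k => b k = b (K z) ∧ F k (C z)) ⟨K z, rfl, hF⟩
    exact Or.inr ⟨_, ⟨hz, spec.2⟩, spec.1⟩
  · exact Or.inl hF

lemma sum_mul_pr_binDecode_ne_le [Fintype σ] [Fintype H] {μ : H → ℝ} {b : H → κ → σ}
    (hμ : μ ∈ stdSimplex ℝ H) (hb : IsUniversal μ b)
    (hp : ∀ z, 0 ≤ p z) (K : Z → κ) (C : Z → Y) (F : κ → Y → Prop) :
    ∑ i, μ i * pr p (fun z => binDecode F (b i) (b i (K z)) (C z) ≠ K z) ≤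
      pr p (fun z => ¬F (K z) (C z)) + (∑ k, pr p fun z => F k (C z)) / Fintype.card σ := by
  classical
  have pr_collision : ∀ k, ∑ i, μ i * pr p (fun z => (k ≠ K z ∧ F k (C z)) ∧ b i k = b i (K z)) ≤
      pr p (fun z => F k (C z)) / Fintype.card σ := fun k => by
    rw [sum_mul_pr_comm, pr, Finset.sum_div]
    refine Finset.sum_le_sum fun z _ => ?_
    by_cases hF : F k (C z)
    · by_cases hk : k = K z
      · simpa [hk, hk ▸ hF, pr] using div_nonneg (hp z) (Nat.cast_nonneg (Fintype.card σ))
      · simpa [hF, hk, div_eq_mul_inv] using mul_le_mul_of_nonneg_left (hb _ _ hk) (hp z)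
    · simp [hF, pr]
  calc ∑ i, μ i * pr p (fun z => binDecode F (b i) (b i (K z)) (C z) ≠ K z)
      ≤ ∑ i, μ i * (pr p (fun z => ¬F (K z) (C z)) +
          ∑ k, pr p fun z => (k ≠ K z ∧ F k (C z)) ∧ b i k = b i (K z)) :=
        Finset.sum_le_sum fun i _ =>
          mul_le_mul_of_nonneg_left (pr_binDecode_ne_le hp K C F (b i)) (hμ.1 i)
    _ = pr p (fun z => ¬F (K z) (C z)) +
          ∑ k, ∑ i, μ i * pr p fun z => (k ≠ K z ∧ F k (C z)) ∧ b i k = b i (K z) := by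
        simp only [mul_add, Finset.sum_add_distrib, sum_mul_const hμ, Finset.mul_sum]
        rw [Finset.sum_comm]
    _ ≤ pr p (fun z => ¬F (K z) (C z)) + (∑ k, pr p fun z => F k (C z)) / Fintype.card σ := by
        rw [Finset.sum_div]
        gcongr with k
        exact pr_collision k

end Binning

section OneShot

variable {U T Z X Y ι : Type*} [Fintype U] [Fintype Z] {p : Z → ℝ} {B : Z → T} {q : T → U → ℝ}
  {A : Z → X} {C : Z → Y} {good : U → Z → Prop} {α₁ α₂ θ τ γ : ℝ} {c : ι → U}

/-- The decoder's test whether the codeword `u` fits the observation `y`: their information density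
is at least `log τ`. -/
def Fits (p : Z → ℝ) (B : Z → T) (q : T → U → ℝ) (C : Z → Y) (τ : ℝ) (u : U) (y : Y) : Prop :=
  τ * outLaw p B q u * law p C y ≤ pairLaw p B q C u y

/-- The information densities of `U` with `B`, with `A` and with `C` have prescribed bounds, in
exponential form. -/
structure Typical (p : Z → ℝ) (B : Z → T) (q : T → U → ℝ) (A : Z → X) (C : Z → Y)
    (α₁ α₂ θ τ : ℝ) (u : U) (z : Z) : Prop where
  pos : 0 < outLaw p B q u
  lower : α₁ * outLaw p B q u ≤ q (B z) u
  upper : q (B z) u ≤ α₂ * outLaw p B q u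
  left : pairLaw p B q A u (A z) ≤ θ * outLaw p B q u * law p A (A z)
  right : Fits p B q C τ u (C z)

lemma pr_fits_le (hp : ∀ z, 0 ≤ p z) (hq : ∀ t, q t ∈ stdSimplex ℝ U) (hτ : 0 < τ) {y : Y}
    (hy : 0 < law p C y) : pr (outLaw p B q) (fun u => Fits p B q C τ u y) ≤ 1 / τ := by
  classical
  refine le_of_mul_le_mul_right ?_ (mul_pos hτ hy)
  rw [one_div, inv_mul_cancel_left₀ hτ.ne', ← sum_pairLaw p B hq, pr,
    Finset.sum_mul]
  refine Finset.sum_le_sum fun u _ => ?_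
  split_ifs with h
  · rw [sum_pairLaw p B hq]
    exact (mul_left_comm _ _ _).trans_le ((mul_assoc _ _ _).symm.trans_le h)
  · simpa [pairLaw] using
      law_nonneg (joint_nonneg hp B fun t => (hq t).1) (fun ω => (ω.1, C ω.2)) (u, y)

lemma sum_prodWeight_mul_pr_fits_le [Fintype ι] [DecidableEq ι] (hp : p ∈ stdSimplex ℝ Z)
    (hq : ∀ t, q t ∈ stdSimplex ℝ U) (C : Z → Y) (hτ : 0 < τ) (j : ι) :
    ∑ c : ι → U, prodWeight ι (outLaw p B q) c * pr p (fun z => Fits p B q C τ (c j) (C z)) ≤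
      1 / τ := by
  rw [sum_mul_pr_comm, ← sum_mul_const hp (1 / τ)]
  refine sum_mul_le_of_pos hp.1 fun z hz => ?_
  rw [pr_prodWeight_apply (outLaw_mem_stdSimplex hp B hq) j fun u => Fits p B q C τ u (C z)]
  exact pr_fits_le hp.1 hq hτ (law_pos hp.1 C hz)

lemma exists_codebook [Finite T] [Fintype ι] (hp : p ∈ stdSimplex ℝ Z)
    (hq : ∀ t, q t ∈ stdSimplex ℝ U) (C : Z → Y) (hα₂ : 0 < α₂) (hτ : 0 < τ) (hγ : 0 < γ)
    (hγ_one : γ ≤ 1) (hgood : ∀ u z, good u z → q (B z) u ≤ α₂ * outLaw p B q u) {N : ℝ}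
    (hN : 0 ≤ N) :
    ∃ c : ι → U, pr p (fun z => ∀ j, ¬Admissible p B good γ (c j) (B z)) +
        (∑ j, pr p fun z => Fits p B q C τ (c j) (C z)) / N ≤
      pr (joint p B q) (fun ω => ¬good ω.1 ω.2) / γ + Real.exp (-(Fintype.card ι / α₂)) +
        Fintype.card ι / τ / N := by
  classical
  refine exists_le_of_sum_mul_le
    (prodWeight_mem_stdSimplex (ι := ι) (outLaw_mem_stdSimplex hp B hq)) ?_
  have covering := sum_prodWeight_mul_pr_uncovered_le (ι := ι) hp hq hα₂
    (R := Admissible p B good γ) fun u t h =>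
      h.of_good (R := fun u t => q t u ≤ α₂ * outLaw p B q u) hp.1 hγ_one hgood
  have packing : ∑ c : ι → U, prodWeight ι (outLaw p B q) c *
      ∑ j, pr p (fun z => Fits p B q C τ (c j) (C z)) ≤ Fintype.card ι / τ := by
    simp only [Finset.mul_sum]
    rw [Finset.sum_comm]
    refine (Finset.sum_le_sum fun j _ => sum_prodWeight_mul_pr_fits_le hp hq C hτ j).trans_eq ?_
    simp [div_eq_mul_inv]
  simp only [mul_add, Finset.sum_add_distrib, ← mul_div_assoc, ← Finset.sum_div]
  gcongr
  exact covering.trans (add_le_add (pr_not_admissible_le hp.1 hq hγ) le_rfl)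

lemma sum_mul_deficit_bin_le {σ H : Type*} [Finite T] [Fintype X] [Fintype σ] [Fintype H]
    {μ : H → ℝ} (hμ : μ ∈ stdSimplex ℝ H) {b : H → Option ι → σ} (hb : IsUniversal μ b)
    (hp : p ∈ stdSimplex ℝ Z) (hq : ∀ t, q t ∈ stdSimplex ℝ U) (hα₁ : 0 < α₁) (hθ : 0 ≤ θ)
    (hγ : 0 ≤ γ) (hγ_one : γ ≤ 1) (hgood : good = Typical p B q A C α₁ α₂ θ τ) (c : ι → U) :
    ∑ i, μ i * deficit p (fun z => b i (quantize (Admissible p B good γ) c (B z))) A ≤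
      Real.log (1 + Fintype.card σ * (θ / α₁)) +
        (pr p (fun z => ∀ j, ¬Admissible p B good γ (c j) (B z)) + γ) *
          Real.log (1 + Fintype.card σ) := by
  have g_nonneg : 0 ≤ θ / α₁ := div_nonneg hθ hα₁.le
  refine (sum_mul_deficit_hash_le_of_condLaw_le hμ hb hp _ A g_nonneg
    (E := Success B good (Admissible p B good γ) c) ?_).trans ?_
  · rintro z ⟨j, hj, hz⟩
    subst hgood
    refine div_le_of_le_mul₀ (law_nonneg hp.1 _ _) g_nonneg (le_of_mul_le_mul_left ?_ hz.pos)
    rw [hj]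
    exact (outLaw_mul_law_quantize_le hp.1 (fun t => (hq t).1) hα₁
      (fun u t h => h.of_good (R := fun u t => α₁ * outLaw p B q u ≤ q t u) hp.1 hγ_one
        fun _ _ hz => hz.lower) c A j (A z)).trans
        ((div_le_div_of_nonneg_right hz.left hα₁.le).trans_eq (by ring))
  · gcongr
    · exact Real.log_nonneg (le_add_of_nonneg_right (Nat.cast_nonneg _))
    · exact pr_not_success_le hp hγ c

lemma pr_law_lt_le {Ω ρ : Type*} [Fintype Ω] [Fintype ρ] {p : Ω → ℝ} (hp : ∀ ω, 0 ≤ p ω)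
    (W : Ω → ρ) {x : ℝ} (hx : 0 ≤ x) :
    pr p (fun ω => law p W (W ω) < x) ≤ Fintype.card ρ * x := by
  rw [← sum_pr_eq_and p W, ← nsmul_eq_mul]
  refine Finset.sum_le_card_nsmul _ _ _ fun w _ => ?_
  by_cases hw : law p W w < x
  · exact (pr_mono hp fun _ _ h => h.1).trans hw.le
  · rw [pr_eq_zero]
    · exact hx
    · rintro ω ⟨rfl, h⟩
      exact hw h

lemma law_quantize_pair_le {ρ : Type*} (hp : p ∈ stdSimplex ℝ Z)
    (hq : ∀ t, q t ∈ stdSimplex ℝ U) (hα₁ : 0 < α₁) {R : U → T → Prop}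
    (hR : ∀ u t, R u t → 0 < outLaw p B q u ∧ α₁ * outLaw p B q u ≤ q t u) (W : Z → ρ) {z : Z}
    (hz : quantize R c (B z) ≠ none) :
    law p (fun z => (quantize R c (B z), W z)) (quantize R c (B z), W z) ≤ 1 / α₁ := by
  obtain ⟨j, hj⟩ := Option.ne_none_iff_exists'.1 hz
  refine le_of_mul_le_mul_left ?_ (hR _ _ (rel_of_quantize_eq_some hj)).1
  rw [mul_one_div, hj]
  exact (outLaw_mul_law_quantize_le hp.1 (fun t => (hq t).1) hα₁ (fun u t h => (hR u t h).2) c W j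
    (W z)).trans (div_le_div_of_nonneg_right
      (law_pair_le_left (joint_mem_stdSimplex hp B hq).1 _ _ _ _) hα₁.le)

lemma sum_mul_deficit_key_le {σ ρ H : Type*} [Fintype σ] [Fintype ρ] [Fintype H] {μ : H → ℝ}
    (hμ : μ ∈ stdSimplex ℝ H) {h : H → Option ι → σ} (hh : IsUniversal μ h)
    (hp : p ∈ stdSimplex ℝ Z) (hq : ∀ t, q t ∈ stdSimplex ℝ U) (hα₁ : 0 < α₁) (hγ_one : γ ≤ 1)
    (hgood : ∀ u z, good u z → 0 < outLaw p B q u ∧ α₁ * outLaw p B q u ≤ q (B z) u) (c : ι → U)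
    (b : Option ι → ρ) {ξ : ℝ} (hξ : 0 < ξ) :
    ∑ i, μ i * deficit p (fun z => h i (quantize (Admissible p B good γ) c (B z)))
        (fun z => b (quantize (Admissible p B good γ) c (B z))) ≤
      Real.log (1 + Fintype.card σ * (Fintype.card ρ * ξ / α₁)) +
        (pr p (fun z => ∀ j, ¬Admissible p B good γ (c j) (B z)) + 1 / ξ) *
          Real.log (1 + Fintype.card σ) := by
  set K : Z → Option ι := fun z => quantize (Admissible p B good γ) c (B z)
  set W : Z → ρ := fun z => b (K z)
  have : Nonempty ρ := (nonempty_of_mem_stdSimplex hp).map W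
  have : (0 : ℝ) < Fintype.card ρ := Nat.cast_pos.2 Fintype.card_pos
  refine (sum_mul_deficit_hash_le_of_condLaw_le hμ hh hp K W
    (g := Fintype.card ρ * ξ / α₁) (by positivity)
    (E := fun z => K z ≠ none ∧ 1 / (Fintype.card ρ * ξ) ≤ law p W (W z)) ?_).trans ?_
  · rintro z ⟨hz, hW⟩
    have law_le := law_quantize_pair_le hp hq hα₁ (fun u t h => h.of_good
      (R := fun u t => 0 < outLaw p B q u ∧ α₁ * outLaw p B q u ≤ q t u) hp.1 hγ_one hgood) W hz
    refine div_le_of_le_mul₀ (law_nonneg hp.1 _ _) (by positivity) (law_le.trans ?_)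
    refine le_trans (le_of_eq ?_) (mul_le_mul_of_nonneg_left hW
      (show 0 ≤ Fintype.card ρ * ξ / α₁ by positivity))
    field_simp
  · gcongr
    · exact Real.log_nonneg (le_add_of_nonneg_right (Nat.cast_nonneg _))
    · refine (pr_mono hp.1 fun z _ hz => ?_).trans ((pr_or_le hp.1 _ _).trans (add_le_add le_rfl
        ((pr_law_lt_le hp.1 W (x := 1 / (Fintype.card ρ * ξ)) (by positivity)).trans_eq ?_)))
      · rcases not_and_or.1 hz with h | h
        · exact Or.inl (quantize_eq_none.1 (not_not.1 h))
        · exact Or.inr (not_le.1 h)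
      · field_simp

/-- The decoder's test for the index of a codeword; the index `none` of a failed quantization
never passes. -/
def IndexFits (p : Z → ℝ) (B : Z → T) (q : T → U → ℝ) (C : Z → Y) (τ : ℝ) (c : ι → U)
    (k : Option ι) (y : Y) : Prop :=
  ∃ j, k = some j ∧ Fits p B q C τ (c j) y

lemma sum_mul_pr_binDecode_quantize_ne_le {σ H : Type*} [Finite T] [Fintype ι] [Fintype σ]
    [Fintype H] {μ : H → ℝ} (hμ : μ ∈ stdSimplex ℝ H) {b : H → Option ι → σ}
    (hb : IsUniversal μ b) (hp : p ∈ stdSimplex ℝ Z) (hγ : 0 ≤ γ)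
    (hgood : ∀ u z, good u z → Fits p B q C τ u (C z)) (c : ι → U) :
    ∑ i, μ i * pr p (fun z => binDecode (IndexFits p B q C τ c) (b i)
        (b i (quantize (Admissible p B good γ) c (B z))) (C z) ≠
          quantize (Admissible p B good γ) c (B z)) ≤
      pr p (fun z => ∀ j, ¬Admissible p B good γ (c j) (B z)) + γ +
        (∑ j, pr p fun z => Fits p B q C τ (c j) (C z)) / Fintype.card σ := by
  have sum_eq : ∑ k, pr p (fun z => IndexFits p B q C τ c k (C z)) =
      ∑ j, pr p fun z => Fits p B q C τ (c j) (C z) := by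
    simp [Fintype.sum_option, IndexFits, pr_eq_zero]
  rw [← sum_eq]
  refine (sum_mul_pr_binDecode_ne_le hμ hb hp.1 _ C _).trans (add_le_add ?_ le_rfl)
  refine (pr_mono hp.1 fun z _ hz hs => hz ?_).trans (pr_not_success_le hp hγ c)
  obtain ⟨j, hj, hg⟩ := hs
  exact ⟨j, hj, hgood _ _ hg⟩

lemma exists_binning {σ : Type*} [Finite T] [Fintype X] [Fintype ι] [Fintype σ] [Nonempty σ]
    (hp : p ∈ stdSimplex ℝ Z) (hq : ∀ t, q t ∈ stdSimplex ℝ U) (hα₁ : 0 < α₁) (hθ : 0 ≤ θ)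
    (hγ : 0 ≤ γ) (hγ_one : γ ≤ 1) (hgood : good = Typical p B q A C α₁ α₂ θ τ) (c : ι → U) {ν e : ℝ}
    (hν : 0 ≤ ν) (he : pr p (fun z => ∀ j, ¬Admissible p B good γ (c j) (B z)) + γ +
      (∑ j, pr p fun z => Fits p B q C τ (c j) (C z)) / Fintype.card σ ≤ e) :
    ∃ b : Option ι → σ,
      deficit p (fun z => b (quantize (Admissible p B good γ) c (B z))) A +
        ν * pr p (fun z => binDecode (IndexFits p B q C τ c) b
          (b (quantize (Admissible p B good γ) c (B z))) (C z) ≠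
            quantize (Admissible p B good γ) c (B z)) ≤
        Real.log (1 + Fintype.card σ * (θ / α₁)) + e * Real.log (1 + Fintype.card σ) + ν * e := by
  classical
  have hμ := const_inv_card_mem_stdSimplex (Option ι → σ)
  have leakage := sum_mul_deficit_bin_le hμ isUniversal_functions hp hq hα₁ hθ hγ hγ_one hgood c
  have error := sum_mul_pr_binDecode_quantize_ne_le hμ isUniversal_functions hp (τ := τ) (q := q)
    (C := C) hγ (fun u z h => (hgood ▸ h : Typical p B q A C α₁ α₂ θ τ u z).right) c
  have fits_nonneg : 0 ≤ (∑ j, pr p fun z => Fits p B q C τ (c j) (C z)) / Fintype.card σ :=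
    div_nonneg (Finset.sum_nonneg fun j _ => pr_nonneg hp.1 _) (Nat.cast_nonneg _)
  have log_nonneg : 0 ≤ Real.log (1 + (Fintype.card σ : ℝ)) :=
    Real.log_nonneg (le_add_of_nonneg_right (Nat.cast_nonneg _))
  refine exists_add_mul_le_of_sum_mul_le hμ hν (leakage.trans ?_) (error.trans he)
  gcongr
  linarith

/-- One-shot key agreement. The codebook is random with `|ι|` codewords, and the helper message in
`ρ` and the key in `σ` are random functions of the index of the chosen codeword. -/
lemma exists_oneShot_code {ρ σ : Type*} [Finite T] [Fintype X] [Fintype ι] [Fintype ρ]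
    [Fintype σ] [Nonempty ρ] [Nonempty σ] (hp : p ∈ stdSimplex ℝ Z)
    (hq : ∀ t, q t ∈ stdSimplex ℝ U) {ξ ν e : ℝ} (hα₁ : 0 < α₁) (hα₂ : 0 < α₂) (hθ : 0 ≤ θ)
    (hτ : 0 < τ) (hγ : 0 < γ) (hγ_one : γ ≤ 1) (hξ : 0 < ξ) (hν : 0 ≤ ν)
    (he : pr (joint p B q) (fun ω => ¬Typical p B q A C α₁ α₂ θ τ ω.1 ω.2) / γ +
      Real.exp (-(Fintype.card ι / α₂)) + Fintype.card ι / τ / Fintype.card ρ + γ ≤ e) :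
    ∃ (f : T → ρ × σ) (g : ρ × Y → σ),
      deficit p (fun z => (f (B z)).1) A +
          ν * pr p (fun z => (f (B z)).2 ≠ g ((f (B z)).1, C z)) ≤
        Real.log (1 + Fintype.card ρ * (θ / α₁)) + e * Real.log (1 + Fintype.card ρ) + ν * e ∧
      deficit p (fun z => (f (B z)).2) (fun z => (f (B z)).1) ≤
        Real.log (1 + Fintype.card σ * (Fintype.card ρ * ξ / α₁)) +
          (e + 1 / ξ) * Real.log (1 + Fintype.card σ) := by
  classical
  obtain ⟨c, hc⟩ := exists_codebook (ι := ι) hp hq C hα₂ hτ hγ hγ_one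
    (fun u z (h : Typical p B q A C α₁ α₂ θ τ u z) => h.upper) (Nat.cast_nonneg (Fintype.card ρ))
  obtain ⟨b, hb⟩ := exists_binning (σ := ρ) (A := A) (C := C) (τ := τ) (α₂ := α₂) hp hq hα₁ hθ
    hγ.le hγ_one rfl c (e := e) hν
    ((add_right_comm _ _ _).trans_le ((add_le_add hc le_rfl).trans he))
  obtain ⟨h, hh⟩ := exists_le_of_sum_mul_le (const_inv_card_mem_stdSimplex (Option ι → σ))
    (sum_mul_deficit_key_le (const_inv_card_mem_stdSimplex (Option ι → σ)) isUniversal_functions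
      hp hq hα₁ hγ_one (fun u z (h : Typical p B q A C α₁ α₂ θ τ u z) => ⟨h.pos, h.lower⟩) c b hξ)
  set K : T → Option ι := quantize (Admissible p B (Typical p B q A C α₁ α₂ θ τ) γ) c
  refine ⟨fun t => (b (K t), h (K t)), fun wy => h (binDecode (IndexFits p B q C τ c) b wy.1 wy.2),
    (add_le_add le_rfl (mul_le_mul_of_nonneg_left ?_ hν)).trans hb, hh.trans ?_⟩
  · exact pr_mono hp.1 fun z _ hne heq => hne (congrArg h heq).symm
  · have fits_nonneg : 0 ≤ (∑ j, pr p fun z => Fits p B q C τ (c j) (C z)) / Fintype.card ρ :=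
      div_nonneg (Finset.sum_nonneg fun j _ => pr_nonneg hp.1 _) (Nat.cast_nonneg _)
    gcongr
    · exact Real.log_nonneg (le_add_of_nonneg_right (Nat.cast_nonneg _))
    · linarith

end OneShot

section Chernoff

variable {Ω : Type*} [Fintype Ω] {p : Ω → ℝ}

lemma exists_sum_mul_exp_lt_one (hp : p ∈ stdSimplex ℝ Ω) {f : Ω → ℝ}
    (hf : ∑ ω, p ω * f ω < 0) : ∃ t > 0, ∑ ω, p ω * Real.exp (t * f ω) < 1 := by
  set Λ : ℝ → ℝ := fun t => ∑ ω, p ω * Real.exp (t * f ω)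
  have Λ_zero : Λ 0 = 1 := by simp [Λ, hp.2]
  have deriv : HasDerivAt Λ (∑ ω, p ω * f ω) 0 := by
    refine HasDerivAt.fun_sum fun ω _ => ?_
    simpa using ((hasDerivAt_mul_const (f ω)).exp (x := (0 : ℝ))).const_mul (p ω)
  have slope_neg := ((hasDerivAt_iff_tendsto_slope.1 deriv).eventually_lt_const hf).filter_mono
    (nhdsWithin_mono (0 : ℝ) fun t (ht : t ∈ Set.Ioi 0) => (Set.mem_Ioi.1 ht).ne')
  obtain ⟨t, ht, t_pos : 0 < t⟩ := (slope_neg.and self_mem_nhdsWithin).exists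
  refine ⟨t, t_pos, ?_⟩
  rw [slope_def_field, sub_zero, Λ_zero, div_lt_iff₀ t_pos, zero_mul, sub_neg] at ht
  exact ht

lemma pr_prodWeight_sum_pos_le {ι : Type*} [Fintype ι] [DecidableEq ι] (hp : ∀ ω, 0 ≤ p ω)
    (f : Ω → ℝ) {t : ℝ} (ht : 0 ≤ t) :
    pr (prodWeight ι p) (fun ω => 0 < ∑ i, f (ω i)) ≤
      (∑ ω, p ω * Real.exp (t * f ω)) ^ Fintype.card ι := by
  rw [← Finset.card_univ, ← Finset.prod_const, ← sum_prod_apply]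
  refine Finset.sum_le_sum fun ω _ => ?_
  rw [Finset.prod_mul_distrib, ← Real.exp_sum, ← Finset.mul_sum]
  have weight_nonneg : 0 ≤ prodWeight ι p ω := Finset.prod_nonneg fun i _ => hp (ω i)
  split_ifs with h
  · exact le_mul_of_one_le_right weight_nonneg (Real.one_le_exp (mul_nonneg ht h.le))
  · exact mul_nonneg weight_nonneg (Real.exp_pos _).le

lemma exists_pr_lt_sum_le_pow (hp : p ∈ stdSimplex ℝ Ω) (f : Ω → ℝ) {ε : ℝ} (hε : 0 < ε) :
    ∃ d, 0 ≤ d ∧ d < 1 ∧ ∀ n : ℕ,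
      pr (prodWeight (Fin n) p) (fun ω => n * (∑ a, p a * f a + ε) < ∑ i, f (ω i)) ≤ d ^ n := by
  set m := ∑ a, p a * f a
  obtain ⟨t, ht, lt_one⟩ := exists_sum_mul_exp_lt_one hp (f := fun a => f a - (m + ε)) (by
    simp only [mul_sub, Finset.sum_sub_distrib, sum_mul_const hp]
    linarith)
  refine ⟨_, Finset.sum_nonneg fun a _ => mul_nonneg (hp.1 a) (Real.exp_pos _).le, lt_one,
    fun n => ?_⟩
  simpa [m, mul_add, Finset.sum_add_distrib] using
    pr_prodWeight_sum_pos_le (ι := Fin n) hp.1 (fun a => f a - (m + ε)) ht.le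

lemma exists_pr_exists_lt_sum_le_pow {κ : Type*} [Fintype κ] (hp : p ∈ stdSimplex ℝ Ω)
    (f : κ → Ω → ℝ) {ε : ℝ} (hε : 0 < ε) :
    ∃ d, 0 ≤ d ∧ d < 1 ∧ ∀ n : ℕ,
      pr (prodWeight (Fin n) p) (fun ω => ∃ k, n * (∑ a, p a * f k a + ε) < ∑ i, f k (ω i)) ≤
        Fintype.card κ * d ^ n := by
  choose d d_nonneg d_lt hd using fun k => exists_pr_lt_sum_le_pow hp (f k) hε
  have near_one : ∀ᶠ x in nhdsWithin (1 : ℝ) (Set.Iio 1), 0 ≤ x ∧ ∀ k, d k ≤ x :=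
    ((eventually_ge_nhds one_pos).and (Filter.eventually_all.2 fun k =>
      eventually_ge_nhds (d_lt k))).filter_mono nhdsWithin_le_nhds
  obtain ⟨x, ⟨x_nonneg, d_le⟩, x_lt⟩ := (near_one.and self_mem_nhdsWithin).exists
  refine ⟨x, x_nonneg, x_lt, fun n => ?_⟩
  rw [← nsmul_eq_mul]
  exact (pr_exists_le (prodWeight_mem_stdSimplex hp).1 _).trans (Finset.sum_le_card_nsmul _ _ _
    fun k _ => (hd k n).trans (pow_le_pow_left₀ (d_nonneg k) (d_le k) n))

end Chernoff

section InfoDensity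

variable {U T Z X Y : Type*} {p : Z → ℝ} {B : Z → T} {q : T → U → ℝ}

lemma pos_of_joint_pos (hp : ∀ z, 0 ≤ p z) {ω : U × Z} (h : 0 < joint p B q ω) :
    0 < p ω.2 ∧ 0 < q (B ω.2) ω.1 := by
  have p_pos := (hp ω.2).lt_of_ne fun h0 => by simp [joint, ← h0] at h
  exact ⟨p_pos, (pos_iff_pos_of_mul_pos h).1 p_pos⟩

variable [Fintype Z]

lemma law_pos_of_joint_pos (hp : ∀ z, 0 ≤ p z) (D : Z → X) {ω : U × Z}
    (h : 0 < joint p B q ω) : 0 < law p D (D ω.2) :=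
  law_pos hp D (pos_of_joint_pos hp h).1

variable [Fintype U]

/-- The information density of the channel output and the random variable `D` under
`joint p B q`. -/
def infoDensity (p : Z → ℝ) (B : Z → T) (q : T → U → ℝ) (D : Z → X) (ω : U × Z) : ℝ :=
  Real.log (pairLaw p B q D ω.1 (D ω.2) / (outLaw p B q ω.1 * law p D (D ω.2)))

lemma outLaw_pos (hp : ∀ z, 0 ≤ p z) (hq : ∀ t u, 0 ≤ q t u) {ω : U × Z}
    (h : 0 < joint p B q ω) : 0 < outLaw p B q ω.1 :=
  law_pos (joint_nonneg hp B hq) (fun ω => ω.1) h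

lemma pairLaw_pos (hp : ∀ z, 0 ≤ p z) (hq : ∀ t u, 0 ≤ q t u) (D : Z → X) {ω : U × Z}
    (h : 0 < joint p B q ω) : 0 < pairLaw p B q D ω.1 (D ω.2) :=
  law_pos (joint_nonneg hp B hq) (fun ω => (ω.1, D ω.2)) h

lemma pairLaw_self (p : Z → ℝ) (B : Z → T) (q : T → U → ℝ) (u : U) (t : T) :
    pairLaw p B q B u t = law p B t * q t u := by
  classical
  rw [pairLaw_eq_law, law, law, pr, pr, Finset.sum_mul]
  refine Finset.sum_congr rfl fun z _ => ?_
  by_cases h : B z = t <;> simp [h]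

lemma exp_infoDensity (hp : ∀ z, 0 ≤ p z) (hq : ∀ t u, 0 ≤ q t u) (D : Z → X) {ω : U × Z}
    (h : 0 < joint p B q ω) : Real.exp (infoDensity p B q D ω) =
      pairLaw p B q D ω.1 (D ω.2) / (outLaw p B q ω.1 * law p D (D ω.2)) :=
  Real.exp_log (div_pos (pairLaw_pos hp hq D h)
    (mul_pos (outLaw_pos hp hq h) (law_pos_of_joint_pos hp D h)))

lemma exp_infoDensity_self (hp : ∀ z, 0 ≤ p z) (hq : ∀ t u, 0 ≤ q t u) {ω : U × Z}
    (h : 0 < joint p B q ω) :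
    Real.exp (infoDensity p B q B ω) = q (B ω.2) ω.1 / outLaw p B q ω.1 := by
  rw [exp_infoDensity hp hq B h, pairLaw_self, mul_comm (outLaw p B q ω.1),
    mul_div_mul_left _ _ (law_pos_of_joint_pos hp B h).ne']

lemma sum_joint_mul_infoDensity [Fintype X] (hp : ∀ z, 0 ≤ p z) (hq : ∀ t, q t ∈ stdSimplex ℝ U)
    (D : Z → X) : ∑ ω, joint p B q ω * infoDensity p B q D ω =
      info (joint p B q) (fun ω => ω.1) fun ω => D ω.2 := by
  have hq' := fun t => (hq t).1
  have split := sum_mul_congr_of_pos (joint_nonneg hp B hq') fun ω h =>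
    (Real.log_div (pairLaw_pos hp hq' D h).ne' (mul_pos (outLaw_pos hp hq' h)
      (law_pos_of_joint_pos hp D h)).ne').trans (congrArg _
        (Real.log_mul (outLaw_pos hp hq' h).ne' (law_pos_of_joint_pos hp D h).ne'))
  have law_snd : law (joint p B q) (fun ω => D ω.2) = law p D :=
    funext fun d => pr_joint_snd p hq fun z => D z = d
  rw [info, ent_eq_sum, ent_eq_sum, ent_eq_sum, law_snd]
  refine split.trans ?_
  simp only [mul_sub, mul_add, Finset.sum_sub_distrib, Finset.sum_add_distrib, outLaw, pairLaw]
  ring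

lemma sum_joint_mul_exp_infoDensity_sub_le (hp : p ∈ stdSimplex ℝ Z)
    (hq : ∀ t, q t ∈ stdSimplex ℝ U) (C : Z → Y) :
    ∑ ω, joint p B q ω * Real.exp (infoDensity p B q C ω - infoDensity p B q B ω) ≤ 1 := by
  have hq' := fun t => (hq t).1
  have joint_nonneg := joint_nonneg hp.1 B hq'
  have term_le : ∀ ω, joint p B q ω * Real.exp (infoDensity p B q C ω - infoDensity p B q B ω) ≤
      p ω.2 * (pairLaw p B q C ω.1 (C ω.2) / law p C (C ω.2)) := fun ω => by
    rcases (joint_nonneg ω).eq_or_lt with h | h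
    · rw [← h, zero_mul]
      exact mul_nonneg (hp.1 _) (div_nonneg (law_nonneg joint_nonneg _ _) (law_nonneg hp.1 _ _))
    · rw [Real.exp_sub, exp_infoDensity hp.1 hq' C h, exp_infoDensity_self hp.1 hq' h, joint]
      have out_pos := outLaw_pos hp.1 hq' h
      have q_pos := (pos_of_joint_pos hp.1 h).2
      have law_pos := law_pos_of_joint_pos hp.1 C h
      exact le_of_eq (by field_simp)
  calc ∑ ω, joint p B q ω * Real.exp (infoDensity p B q C ω - infoDensity p B q B ω)
      ≤ ∑ ω : U × Z, p ω.2 * (pairLaw p B q C ω.1 (C ω.2) / law p C (C ω.2)) :=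
        Finset.sum_le_sum fun ω _ => term_le ω
    _ = ∑ z, p z * (law p C (C z) / law p C (C z)) := by
        simp only [Fintype.sum_prod_type_right, ← Finset.mul_sum, ← Finset.sum_div,
          sum_pairLaw p B hq]
    _ ≤ ∑ z, p z * 1 := sum_mul_le_of_pos hp.1 fun z _ => div_self_le_one _
    _ = 1 := sum_mul_const hp 1

lemma info_joint_le_info_joint_self [Fintype T] [Fintype Y] (hp : p ∈ stdSimplex ℝ Z)
    (hq : ∀ t, q t ∈ stdSimplex ℝ U) (C : Z → Y) :
    info (joint p B q) (fun ω => ω.1) (fun ω => C ω.2) ≤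
      info (joint p B q) (fun ω => ω.1) fun ω => B ω.2 := by
  have jensen := sum_mul_log_le_log (joint_mem_stdSimplex hp B hq) (fun ω _ => Real.exp_pos _)
    one_pos (sum_joint_mul_exp_infoDensity_sub_le hp hq C)
  simp only [Real.log_exp, mul_sub, Finset.sum_sub_distrib, Real.log_one,
    sum_joint_mul_infoDensity hp.1 hq] at jensen
  exact sub_nonpos.1 jensen

lemma typical_of_infoDensity (hp : ∀ z, 0 ≤ p z) (hq : ∀ t u, 0 ≤ q t u) {A : Z → X} {C : Z → Y}
    {a₁ a₂ a₃ a₄ : ℝ} {ω : U × Z} (h : 0 < joint p B q ω) (lower : a₁ ≤ infoDensity p B q B ω)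
    (upper : infoDensity p B q B ω ≤ a₂) (left : infoDensity p B q A ω ≤ a₃)
    (right : a₄ ≤ infoDensity p B q C ω) :
    Typical p B q A C (Real.exp a₁) (Real.exp a₂) (Real.exp a₃) (Real.exp a₄) ω.1 ω.2 := by
  have out_pos := outLaw_pos hp hq h
  have exp_self := exp_infoDensity_self hp hq h
  refine ⟨out_pos, ?_, ?_, ?_, ?_⟩
  · rw [← le_div_iff₀ out_pos, ← exp_self]
    exact Real.exp_le_exp.2 lower
  · rw [← div_le_iff₀ out_pos, ← exp_self]
    exact Real.exp_le_exp.2 upper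
  · rw [mul_assoc, ← div_le_iff₀ (mul_pos out_pos (law_pos_of_joint_pos hp A h)),
      ← exp_infoDensity hp hq A h]
    exact Real.exp_le_exp.2 left
  · rw [Fits, mul_assoc, ← le_div_iff₀ (mul_pos out_pos (law_pos_of_joint_pos hp C h)),
      ← exp_infoDensity hp hq C h]
    exact Real.exp_le_exp.2 right

end InfoDensity

section Blocks

variable {U T Z X Y ι : Type*} [Fintype ι]

/-- The memoryless extension of the channel `q`. -/
def prodChannel (ι : Type*) [Fintype ι] (q : T → U → ℝ) (t : ι → T) (u : ι → U) : ℝ :=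
  ∏ i, q (t i) (u i)

variable [DecidableEq ι] [Fintype U] {p : Z → ℝ} {B : Z → T} {q : T → U → ℝ}

lemma prodChannel_mem_stdSimplex (hq : ∀ t, q t ∈ stdSimplex ℝ U) (t : ι → T) :
    prodChannel ι q t ∈ stdSimplex ℝ (ι → U) :=
  ⟨fun _ => Finset.prod_nonneg fun _ _ => (hq _).1 _, by
    simp only [prodChannel, sum_prod_apply fun i => q (t i), (hq _).2, Finset.prod_const_one]⟩

variable [Fintype Z]

lemma pr_joint_prodChannel (E : (ι → U) × (ι → Z) → Prop) :
    pr (joint (prodWeight ι p) (fun z => B ∘ z) (prodChannel ι q)) E =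
      pr (prodWeight ι (joint p B q)) fun ω => E (fun i => (ω i).1, fun i => (ω i).2) := by
  rw [pr, ← (Equiv.arrowProdEquivProdArrow ι (fun _ => U) fun _ => Z).sum_comp]
  refine Finset.sum_congr rfl fun ω _ => ?_
  simp only [joint, prodWeight, prodChannel, Finset.prod_mul_distrib]
  rfl

lemma outLaw_prodChannel (u : ι → U) :
    outLaw (prodWeight ι p) (fun z => B ∘ z) (prodChannel ι q) u = ∏ i, outLaw p B q (u i) := by
  rw [outLaw, law, pr_joint_prodChannel]
  exact law_prod (fun _ => joint p B q) Prod.fst u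

lemma pairLaw_prodChannel (D : Z → X) (u : ι → U) (x : ι → X) :
    pairLaw (prodWeight ι p) (fun z => B ∘ z) (prodChannel ι q) (fun z => D ∘ z) u x =
      ∏ i, pairLaw p B q D (u i) (x i) := by
  simp only [pairLaw_eq_law]
  rw [← law_prod]
  simp [prodWeight, prodChannel, Finset.prod_mul_distrib]

lemma infoDensity_prodChannel (hp : ∀ z, 0 ≤ p z) (hq : ∀ t u, 0 ≤ q t u) (D : Z → X)
    {ω : ι → U × Z} (h : ∀ i, 0 < joint p B q (ω i)) :
    infoDensity (prodWeight ι p) (fun z => B ∘ z) (prodChannel ι q) (fun z => D ∘ z)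
      (fun i => (ω i).1, fun i => (ω i).2) = ∑ i, infoDensity p B q D (ω i) := by
  have law_prod : law (prodWeight ι p) (fun z => D ∘ z) (D ∘ fun i => (ω i).2) = _ :=
    law_prod (fun _ => p) D _
  rw [infoDensity, outLaw_prodChannel, pairLaw_prodChannel, law_prod, ← Finset.prod_mul_distrib,
    ← Finset.prod_div_distrib, Real.log_prod]
  · rfl
  · exact fun i _ => (div_pos (pairLaw_pos hp hq D (h i))
      (mul_pos (outLaw_pos hp hq (h i)) (law_pos_of_joint_pos hp D (h i)))).ne'

lemma exists_pr_not_typical_le [Fintype T] [Fintype X] [Fintype Y] (hp : p ∈ stdSimplex ℝ Z)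
    (hq : ∀ t, q t ∈ stdSimplex ℝ U) (A : Z → X) (C : Z → Y) {ε : ℝ} (hε : 0 < ε) :
    ∃ d, 0 ≤ d ∧ d < 1 ∧ ∀ n : ℕ,
      pr (joint (prodWeight (Fin n) p) (fun z => B ∘ z) (prodChannel (Fin n) q)) (fun ω =>
        ¬Typical (prodWeight (Fin n) p) (fun z => B ∘ z) (prodChannel (Fin n) q)
          (fun z => A ∘ z) (fun z => C ∘ z)
          (Real.exp (n * (info (joint p B q) (fun ω => ω.1) (fun ω => B ω.2) - ε)))
          (Real.exp (n * (info (joint p B q) (fun ω => ω.1) (fun ω => B ω.2) + ε)))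
          (Real.exp (n * (info (joint p B q) (fun ω => ω.1) (fun ω => A ω.2) + ε)))
          (Real.exp (n * (info (joint p B q) (fun ω => ω.1) (fun ω => C ω.2) - ε)))
          ω.1 ω.2) ≤ 4 * d ^ n := by
  have hq' := fun t => (hq t).1
  have joint_mem := joint_mem_stdSimplex hp B hq
  obtain ⟨d, d_nonneg, d_lt, deviation⟩ := exists_pr_exists_lt_sum_le_pow joint_mem
    ![fun ω => -infoDensity p B q B ω, infoDensity p B q B, infoDensity p B q A,
      fun ω => -infoDensity p B q C ω] hε
  refine ⟨d, d_nonneg, d_lt, fun n => ?_⟩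
  rw [pr_joint_prodChannel]
  refine (pr_mono (prodWeight_mem_stdSimplex joint_mem).1 fun ω h => ?_).trans (deviation n)
  have joint_pos : ∀ i, 0 < joint p B q (ω i) := fun i =>
    (joint_mem.1 _).lt_of_ne fun h0 => h.ne' (Finset.prod_eq_zero (Finset.mem_univ i) h0.symm)
  have block_pos : 0 < joint (prodWeight (Fin n) p) (fun z => B ∘ z) (prodChannel (Fin n) q)
      (fun i => (ω i).1, fun i => (ω i).2) := by
    simpa only [joint, prodWeight, prodChannel, Finset.prod_mul_distrib, Function.comp_apply]
      using h
  contrapose!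
  intro close
  have lower := close 0
  have upper := close 1
  have left := close 2
  have right := close 3
  simp only [Nat.succ_eq_add_one, Nat.reduceAdd, Fin.isValue, Matrix.cons_val',
    Matrix.cons_val_fin_one, Matrix.cons_val_zero, Finset.sum_neg_distrib, mul_neg,
    sum_joint_mul_infoDensity hp.1 hq, Matrix.cons_val_one, Matrix.cons_val]
    at lower upper left right
  refine typical_of_infoDensity (prodWeight_mem_stdSimplex hp).1
    (fun t => (prodChannel_mem_stdSimplex hq t).1) block_pos ?_ ?_ ?_ ?_ <;>
  rw [infoDensity_prodChannel hp.1 hq' _ joint_pos] <;> linarith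

end Blocks

section BlockCode

open Filter

lemma natCeil_exp_le {x : ℝ} (hx : 0 ≤ x) : (⌈Real.exp x⌉₊ : ℝ) ≤ 2 * Real.exp x := by
  have ceil_lt := Nat.ceil_lt_add_one (Real.exp_pos x).le
  have one_le := Real.one_le_exp hx
  linarith

lemma log_one_add_le_of_le_two_mul_exp {x y : ℝ} (hx : 0 ≤ x) (hy : 0 ≤ y)
    (h : y ≤ 2 * Real.exp x) : Real.log (1 + y) ≤ 2 + x := by
  rw [Real.log_le_iff_le_exp (by positivity), Real.exp_add]
  have one_le := Real.one_le_exp hx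
  have three_le : 3 ≤ Real.exp 2 := by linarith [Real.add_one_le_exp (2 : ℝ)]
  nlinarith

lemma eventually_pow_mul_quadratic_le {r : ℝ} (hr : 0 ≤ r) (hr_one : r < 1) (a b c : ℝ) {δ : ℝ}
    (hδ : 0 < δ) : ∀ᶠ n : ℕ in atTop, r ^ n * (a + b * n + c * n ^ 2) ≤ δ := by
  have lim (k : ℕ) (x : ℝ) : Tendsto (fun n : ℕ => x * ((n : ℝ) ^ k * r ^ n)) atTop (nhds 0) := by
    simpa using (tendsto_pow_const_mul_const_pow_of_abs_lt_one k
      (by rwa [abs_of_nonneg hr])).const_mul x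
  have sum_lim := ((lim 0 a).add (lim 1 b)).add (lim 2 c)
  rw [add_zero, add_zero] at sum_lim
  filter_upwards [sum_lim.eventually_le_const hδ] with n hn
  exact (by ring : _ = _).trans_le hn

/-- The requirements on helper data `W`, a key `S` and a key estimate `S'`. Leakage and secrecy are
measured by deficits, because these are what random binning controls and they do not change when
the key is used as a one-time pad. -/
structure MeetsBounds {Ω X : Type*} [Fintype Ω] [Fintype X] {MW MS : ℕ} (p : Ω → ℝ) (A : Ω → X)
    (W : Ω → Fin MW) (S S' : Ω → Fin MS) (leakage storage δ : ℝ) : Prop where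
  leakage_le : deficit p W A ≤ leakage
  storage_le : Real.log MW ≤ storage
  error_le : pr p (fun ω => S ω ≠ S' ω) ≤ δ
  secrecy_le : deficit p S W ≤ δ

section Exponents

variable {IT IX IY e γ : ℝ} {M MW MS : ℕ}

lemma code_error_le (he : 0 ≤ e) (hIT : 0 ≤ IT) (hγ : 0 < γ) (heγ : Real.exp (-e) ≤ γ) {η : ℝ}
    (hη : η ≤ 4 * γ ^ 2) (hM : M = ⌈Real.exp (IT + 2 * e)⌉₊)
    (hMW : Real.exp (IT - IY + 4 * e) ≤ MW) :
    η / γ + Real.exp (-(M / Real.exp (IT + e))) + M / Real.exp (IY - e) / MW + γ ≤ 8 * γ := by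
  have atypical : η / γ ≤ 4 * γ := by
    rw [div_le_iff₀ hγ]
    linarith
  have uncovered : Real.exp (-(M / Real.exp (IT + e))) ≤ Real.exp (-e) := by
    rw [Real.exp_le_exp, neg_le_neg_iff, le_div_iff₀ (Real.exp_pos _)]
    calc e * Real.exp (IT + e) ≤ Real.exp e * Real.exp (IT + e) := by
          gcongr
          linarith [Real.add_one_le_exp e]
      _ = Real.exp (IT + 2 * e) := by
          rw [← Real.exp_add]
          ring_nf
      _ ≤ M := hM ▸ Nat.le_ceil _
  have confused : M / Real.exp (IY - e) / MW ≤ 2 * Real.exp (-e) := by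
    rw [div_div, div_le_iff₀ (mul_pos (Real.exp_pos _) ((Real.exp_pos _).trans_le hMW))]
    calc (M : ℝ) ≤ 2 * Real.exp (IT + 2 * e) := hM ▸ natCeil_exp_le (by positivity)
      _ = 2 * Real.exp (-e) * (Real.exp (IY - e) * Real.exp (IT - IY + 4 * e)) := by
          rw [← Real.exp_add, mul_assoc, ← Real.exp_add]
          ring_nf
      _ ≤ 2 * Real.exp (-e) * (Real.exp (IY - e) * MW) := by gcongr
  linarith

lemma log_one_add_leakage_le (he : 0 ≤ e) (hMW : (MW : ℝ) ≤ 2 * Real.exp (IT - IY + 4 * e)) :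
    Real.log (1 + MW * (Real.exp (IX + e) / Real.exp (IT - e))) ≤
      2 + (max 0 (IX - IY) + 6 * e) := by
  refine log_one_add_le_of_le_two_mul_exp (by positivity) (by positivity) ?_
  calc MW * (Real.exp (IX + e) / Real.exp (IT - e))
      ≤ 2 * Real.exp (IT - IY + 4 * e) * (Real.exp (IX + e) / Real.exp (IT - e)) := by gcongr
    _ = 2 * Real.exp (IX - IY + 6 * e) := by
        rw [← Real.exp_sub, mul_assoc, ← Real.exp_add]
        ring_nf
    _ ≤ 2 * Real.exp (max 0 (IX - IY) + 6 * e) := by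
        gcongr
        exact le_max_right _ _

lemma log_one_add_secrecy_le [NeZero MS] (hMW : (MW : ℝ) ≤ 2 * Real.exp (IT - IY + 4 * e))
    (hMS : Real.log MS ≤ IY - 7 * e) :
    Real.log (1 + MS * (MW * Real.exp e / Real.exp (IT - e))) ≤ 2 * Real.exp (-e) := by
  have MS_pos : (0 : ℝ) < MS := Nat.cast_pos.2 (NeZero.pos MS)
  have MS_le := (Real.log_le_iff_le_exp MS_pos).1 hMS
  have log_le := Real.log_le_sub_one_of_pos
    (show 0 < 1 + MS * (MW * Real.exp e / Real.exp (IT - e)) by positivity)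
  calc Real.log (1 + MS * (MW * Real.exp e / Real.exp (IT - e)))
      ≤ MS * (MW * Real.exp e / Real.exp (IT - e)) := by linarith
    _ ≤ Real.exp (IY - 7 * e) *
          (2 * Real.exp (IT - IY + 4 * e) * Real.exp e / Real.exp (IT - e)) := by gcongr
    _ = 2 * Real.exp (-e) := by
        rw [mul_assoc 2, ← Real.exp_add, mul_div_assoc, ← Real.exp_sub, mul_left_comm,
          ← Real.exp_add]
        ring_nf

end Exponents

variable {U T Z X Y : Type*} [Fintype U] [Fintype Z] [Fintype X] {p : Z → ℝ} {B : Z → T}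
  {q : T → U → ℝ} {A : Z → X} {C : Z → Y}

/-- The alphabet sizes are `exp (IT - IY + 4 * e)` for the helper data and `exp (IT + 2 * e)` for
the codebook, up to rounding. -/
lemma exists_code_of_pr_not_typical_le [Finite T] (hp : p ∈ stdSimplex ℝ Z)
    (hq : ∀ t, q t ∈ stdSimplex ℝ U) {IT IX IY e γ ν : ℝ} (he : 0 ≤ e) (hIT : 0 ≤ IT)
    (hIY : IY ≤ IT) (hγ : 0 < γ) (hγ_one : γ ≤ 1) (heγ : Real.exp (-e) ≤ γ) (hν : 0 ≤ ν)
    (atypical : pr (joint p B q) (fun ω => ¬Typical p B q A C (Real.exp (IT - e))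
      (Real.exp (IT + e)) (Real.exp (IX + e)) (Real.exp (IY - e)) ω.1 ω.2) ≤ 4 * γ ^ 2)
    (MS : ℕ) [NeZero MS] (hMS : Real.log MS ≤ IY - 7 * e) :
    ∃ (MW : ℕ) (f : T → Fin MW × Fin MS) (g : Fin MW × Y → Fin MS),
      deficit p (fun z => (f (B z)).1) A +
          ν * pr p (fun z => (f (B z)).2 ≠ g ((f (B z)).1, C z)) ≤
        2 + (max 0 (IX - IY) + 6 * e) + γ * (8 * (2 + (IT - IY + 4 * e)) + 8 * ν) ∧
      deficit p (fun z => (f (B z)).2) (fun z => (f (B z)).1) ≤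
        γ * (11 + 9 * Real.log MS) ∧
      Real.log MW ≤ 2 + (IT - IY + 4 * e) := by
  have exponent_nonneg : 0 ≤ IT - IY + 4 * e := by linarith
  obtain ⟨MW, hMW⟩ : ∃ MW, MW = ⌈Real.exp (IT - IY + 4 * e)⌉₊ := ⟨_, rfl⟩
  have le_MW : Real.exp (IT - IY + 4 * e) ≤ MW := hMW ▸ Nat.le_ceil _
  have MW_le : (MW : ℝ) ≤ 2 * Real.exp (IT - IY + 4 * e) := hMW ▸ natCeil_exp_le exponent_nonneg
  have MW_pos : (0 : ℝ) < MW := (Real.exp_pos _).trans_le le_MW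
  have : NeZero MW := ⟨(Nat.cast_pos.1 MW_pos).ne'⟩
  have one_le_MS : (1 : ℝ) ≤ MS := Nat.one_le_cast.2 (NeZero.pos MS)
  obtain ⟨f, g, leakage, secrecy⟩ := exists_oneShot_code (ρ := Fin MW) (σ := Fin MS)
    (ι := Fin ⌈Real.exp (IT + 2 * e)⌉₊) hp hq (Real.exp_pos (IT - e)) (Real.exp_pos (IT + e))
    (Real.exp_pos (IX + e)).le (Real.exp_pos (IY - e)) hγ hγ_one (Real.exp_pos e) hν (by
      simpa only [Fintype.card_fin] using code_error_le he hIT hγ heγ atypical rfl le_MW)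
  simp only [Fintype.card_fin] at leakage secrecy
  have log_MW : Real.log (1 + MW) ≤ 2 + (IT - IY + 4 * e) :=
    log_one_add_le_of_le_two_mul_exp exponent_nonneg MW_pos.le MW_le
  have log_MS : Real.log (1 + MS) ≤ 1 + Real.log MS := by
    calc Real.log (1 + MS) ≤ Real.log (2 * MS) := Real.log_le_log (by linarith) (by linarith)
      _ = Real.log 2 + Real.log MS := Real.log_mul two_ne_zero (by linarith)
      _ ≤ 1 + Real.log MS := by linarith [Real.log_le_sub_one_of_pos two_pos]
  refine ⟨MW, f, g, leakage.trans ?_, secrecy.trans ?_,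
    (Real.log_le_log MW_pos (by linarith)).trans log_MW⟩
  · have := log_one_add_leakage_le (IX := IX) he MW_le
    have := mul_le_mul_of_nonneg_left log_MW hγ.le
    linarith
  · have := log_one_add_secrecy_le MW_le hMS
    have log_nonneg : 0 ≤ Real.log (1 + (MS : ℝ)) := Real.log_nonneg (by linarith)
    have error_le : (8 * γ + 1 / Real.exp e) * Real.log (1 + MS) ≤ 9 * γ * (1 + Real.log MS) := by
      gcongr
      rw [one_div, ← Real.exp_neg]
      linarith
    linarith

section Asymptotics

variable [Fintype T] [Fintype Y] {IT IX IY : ℝ}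

lemma exists_blockCode (hp : p ∈ stdSimplex ℝ Z) (hq : ∀ t, q t ∈ stdSimplex ℝ U)
    (hIT : info (joint p B q) (fun ω => ω.1) (fun ω => B ω.2) = IT)
    (hIX : info (joint p B q) (fun ω => ω.1) (fun ω => A ω.2) = IX)
    (hIY : info (joint p B q) (fun ω => ω.1) (fun ω => C ω.2) = IY) {ε : ℝ} (hε : 0 < ε) :
    ∃ r : ℝ, 0 < r ∧ r < 1 ∧ ∀ (n MS : ℕ) [NeZero MS], Real.log MS ≤ n * (IY - 7 * ε) →
      ∃ (MW : ℕ) (f : (Fin n → T) → Fin MW × Fin MS) (g : Fin MW × (Fin n → Y) → Fin MS),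
        deficit (prodWeight (Fin n) p) (fun z => (f (B ∘ z)).1) (fun z => A ∘ z) +
            n ^ 2 * pr (prodWeight (Fin n) p)
              (fun z => (f (B ∘ z)).2 ≠ g ((f (B ∘ z)).1, C ∘ z)) ≤
          2 + n * (max 0 (IX - IY) + 6 * ε) +
            r ^ n * (16 + 8 * (IT - IY + 4 * ε) * n + 8 * n ^ 2) ∧
        deficit (prodWeight (Fin n) p) (fun z => (f (B ∘ z)).2) (fun z => (f (B ∘ z)).1) ≤
          r ^ n * (11 + 9 * Real.log MS) ∧
        Real.log MW ≤ 2 + n * (IT - IY + 4 * ε) := by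
  have IT_nonneg : 0 ≤ IT := hIT ▸ info_nonneg (joint_mem_stdSimplex hp B hq) _ _
  have IY_le : IY ≤ IT := hIT ▸ hIY ▸ info_joint_le_info_joint_self hp hq C
  obtain ⟨d, d_nonneg, d_lt, atypical⟩ := exists_pr_not_typical_le (B := B) hp hq A C hε
  rw [hIT, hIX, hIY] at atypical
  obtain ⟨r, r_pos, r_lt, d_le, exp_le⟩ :
      ∃ r : ℝ, 0 < r ∧ r < 1 ∧ d ≤ r ^ 2 ∧ Real.exp (-ε) ≤ r :=
    ⟨max (Real.sqrt d) (Real.exp (-ε)), lt_max_of_lt_right (Real.exp_pos _),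
      max_lt ((Real.sqrt_lt' one_pos).2 (by simpa using d_lt)) (by simpa using hε),
      (Real.sqrt_le_iff.1 (le_max_left _ _)).2, le_max_right _ _⟩
  refine ⟨r, r_pos, r_lt, fun n MS _ hMS => ?_⟩
  obtain ⟨MW, f, g, leakage, secrecy, storage⟩ := exists_code_of_pr_not_typical_le
    (prodWeight_mem_stdSimplex hp) (prodChannel_mem_stdSimplex hq) (IT := n * IT) (IX := n * IX)
    (IY := n * IY) (e := n * ε) (γ := r ^ n) (ν := n ^ 2) (A := fun z => A ∘ z)
    (B := fun z => B ∘ z) (C := fun z => C ∘ z) (by positivity) (by positivity) (by gcongr)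
    (by positivity) (pow_le_one₀ r_pos.le r_lt.le)
    (by rw [← mul_neg, Real.exp_nat_mul]; gcongr) (by positivity)
    (by
      simp only [← mul_sub, ← mul_add, ← pow_mul, mul_comm n]
      simp only [pow_mul]
      exact (atypical n).trans (by gcongr)) MS (by linarith)
  have max_eq : max 0 (n * IX - n * IY) = n * max 0 (IX - IY) := by
    rw [← mul_sub, mul_max_of_nonneg _ _ n.cast_nonneg, mul_zero]
  exact ⟨MW, f, g, by linarith, secrecy, by linarith⟩

lemma eventually_exists_code (hp : p ∈ stdSimplex ℝ Z) (hq : ∀ t, q t ∈ stdSimplex ℝ U)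
    (hIT : info (joint p B q) (fun ω => ω.1) (fun ω => B ω.2) = IT)
    (hIX : info (joint p B q) (fun ω => ω.1) (fun ω => A ω.2) = IX)
    (hIY : info (joint p B q) (fun ω => ω.1) (fun ω => C ω.2) = IY) {R δ : ℝ} (hR : R < IY)
    (hδ : 0 < δ) :
    ∀ᶠ n : ℕ in atTop, ∀ (MS : ℕ) [NeZero MS], Real.log MS ≤ n * R →
      ∃ (MW : ℕ) (f : (Fin n → T) → Fin MW × Fin MS) (g : Fin MW × (Fin n → Y) → Fin MS),
        MeetsBounds (prodWeight (Fin n) p) (fun z => A ∘ z) (fun z => (f (B ∘ z)).1)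
          (fun z => (f (B ∘ z)).2) (fun z => g ((f (B ∘ z)).1, C ∘ z))
          (n * (max 0 (IX - IY) + δ)) (n * (IT - IY + δ)) δ := by
  obtain ⟨ε, ε_pos, rate_gap, ε_le⟩ : ∃ ε : ℝ, 0 < ε ∧ 7 * ε ≤ IY - R ∧ 12 * ε ≤ δ :=
    ⟨min ((IY - R) / 7) (δ / 12), lt_min (by linarith) (by linarith),
      by linarith [min_le_left ((IY - R) / 7) (δ / 12)],
      by linarith [min_le_right ((IY - R) / 7) (δ / 12)]⟩
  obtain ⟨r, r_pos, r_lt, exists_code⟩ := exists_blockCode (A := A) hp hq hIT hIX hIY ε_pos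
  filter_upwards [eventually_pow_mul_quadratic_le r_pos.le r_lt 16 (8 * (IT - IY + 4 * ε)) 8
      one_pos, eventually_pow_mul_quadratic_le r_pos.le r_lt 11 (9 * R) 0 hδ,
    eventually_gt_atTop 0, tendsto_natCast_atTop_atTop.eventually_ge_atTop (6 / δ),
    tendsto_natCast_atTop_atTop.eventually_ge_atTop ((max 0 (IX - IY) + δ) / δ)]
    with n leakage_small secrecy_small n_pos six_le κ_le MS _ hMS
  rw [div_le_iff₀ hδ] at six_le κ_le
  have n_pos : (0 : ℝ) < n := Nat.cast_pos.2 n_pos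
  have prod_mem := prodWeight_mem_stdSimplex (ι := Fin n) hp
  have ε_le := mul_le_mul_of_nonneg_left ε_le n_pos.le
  obtain ⟨MW, f, g, leakage, secrecy, storage⟩ := exists_code n MS
    (hMS.trans (by gcongr; linarith))
  have total := leakage.trans
    (show _ ≤ n * (max 0 (IX - IY) + δ) by linarith)
  refine ⟨MW, f, g, ?_, by linarith, ?_, ?_⟩
  · exact (le_add_of_nonneg_right (mul_nonneg (by positivity) (pr_nonneg prod_mem.1 _))).trans
      total
  · have deficit_nonneg := deficit_nonneg prod_mem (fun z => (f (B ∘ z)).1) fun z => A ∘ z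
    refine le_of_mul_le_mul_left ?_ (show (0 : ℝ) < n ^ 2 by positivity)
    calc _ ≤ n * (max 0 (IX - IY) + δ) := (le_add_of_nonneg_left deficit_nonneg).trans total
      _ ≤ n * (n * δ) := by gcongr
      _ = n ^ 2 * δ := by ring
  · refine secrecy.trans (le_trans (mul_le_mul_of_nonneg_left ?_ (by positivity)) secrecy_small)
    linarith

end Asymptotics

end BlockCode

section OneTimePad

variable {Ω α β κ : Type*} [Fintype Ω] [Fintype κ] {p : Ω → ℝ}

/-- The weight `p` together with an independent uniformly distributed key in `κ`. -/
def withKey (κ : Type*) [Fintype κ] (p : Ω → ℝ) (ω : Ω × κ) : ℝ := p ω.1 * (Fintype.card κ : ℝ)⁻¹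

lemma pr_withKey (p : Ω → ℝ) (E : Ω × κ → Prop) :
    pr (withKey κ p) E = (∑ k, pr p fun ω => E (ω, k)) * (Fintype.card κ : ℝ)⁻¹ := by
  simp only [pr, withKey, Fintype.sum_prod_type_right, Finset.sum_mul, ite_mul, zero_mul]

variable [AddCommGroup κ]

lemma pr_withKey_fst (p : Ω → ℝ) (E : Ω → Prop) : pr (withKey κ p) (fun ω => E ω.1) = pr p E := by
  simp only [pr_withKey, Finset.sum_const, Finset.card_univ, nsmul_eq_mul]
  rw [mul_comm, inv_mul_cancel_left₀ (Nat.cast_ne_zero.2 Fintype.card_ne_zero)]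

lemma law_withKey_add (p : Ω → ℝ) (A : Ω → α) (S : Ω → κ) (a : α) (t : κ) :
    law (withKey κ p) (fun ω => (A ω.1, S ω.1 + ω.2)) (a, t) =
      law p A a * (Fintype.card κ : ℝ)⁻¹ := by
  rw [law, pr_withKey, law, ← (Equiv.subLeft t).sum_comp,
    ← sum_pr_eq_and p S fun ω => A ω = a]
  simp only [Equiv.subLeft_apply, Prod.mk.injEq, ← add_sub_assoc, sub_eq_iff_eq_add,
    add_comm t, add_left_inj, and_comm]

variable [Fintype α] [Fintype β]

lemma ent_withKey_fst (p : Ω → ℝ) (A : Ω → α) :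
    ent (withKey κ p) (fun ω => A ω.1) = ent p A :=
  Finset.sum_congr rfl fun a _ => congrArg Real.negMulLog (pr_withKey_fst p fun ω => A ω = a)

lemma ent_withKey_add (hp : p ∈ stdSimplex ℝ Ω) (A : Ω → α) (S : Ω → κ) :
    ent (withKey κ p) (fun ω => (A ω.1, S ω.1 + ω.2)) =
      ent p A + Real.log (Fintype.card κ) := by
  have card_ne : (Fintype.card κ : ℝ) ≠ 0 := Nat.cast_ne_zero.2 Fintype.card_ne_zero
  simp only [ent, Fintype.sum_prod_type, law_withKey_add, Real.negMulLog_mul, Finset.sum_const,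
    Finset.card_univ, nsmul_eq_mul, mul_add, mul_inv_cancel_left₀ card_ne,
    Finset.sum_add_distrib, ← Finset.mul_sum, ← Finset.sum_mul, (law_mem_stdSimplex hp A).2]
  simp [Real.negMulLog, card_ne]

lemma ent_withKey_snd (hp : p ∈ stdSimplex ℝ Ω) :
    ent (withKey κ p) (fun ω => ω.2) = Real.log (Fintype.card κ) := by
  have ent_unit : ent p (fun _ => ()) = 0 := by
    have law_unit : law p (fun _ => ()) () = 1 := by
      simpa using (law_mem_stdSimplex hp fun _ => ()).2
    simp [ent, law_unit]
  rw [← zero_add (Real.log _), ← ent_unit, ← ent_withKey_add hp (fun _ => ()) 0,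
    ← ent_comp_equiv _ _ (Equiv.punitProd κ).symm]
  simp only [Pi.zero_apply, zero_add]
  rfl

lemma info_withKey_snd_pad (hp : p ∈ stdSimplex ℝ Ω) (W : Ω → α) (S : Ω → κ) :
    info (withKey κ p) (fun ω => ω.2) (fun ω => (W ω.1, S ω.1 + ω.2)) = deficit p S W := by
  have pair_eq : ent (withKey κ p) (fun ω => (ω.2, W ω.1, S ω.1 + ω.2)) =
      ent p (fun ω => (S ω, W ω)) + Real.log (Fintype.card κ) := by
    rw [← ent_withKey_add hp (fun ω => (S ω, W ω)) 0]
    let e : κ × α × κ ≃ (κ × α) × κ :=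
      { toFun := fun x => ((x.2.2 - x.1, x.2.1), x.1)
        invFun := fun y => (y.2, y.1.2, y.1.1 + y.2)
        left_inv := fun x => by simp
        right_inv := fun y => by simp }
    rw [← ent_comp_equiv _ _ e]
    simp [e]
  rw [info, ent_withKey_snd hp, ent_withKey_add hp, pair_eq, deficit]
  ring

lemma info_withKey_fst_pad (hp : p ∈ stdSimplex ℝ Ω) (A : Ω → α) (W : Ω → β) (S : Ω → κ) :
    info (withKey κ p) (fun ω => A ω.1) (fun ω => (W ω.1, S ω.1 + ω.2)) = info p A W := by
  rw [info, ent_withKey_fst, ent_withKey_add hp,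
    ← ent_comp_equiv _ (fun ω : Ω × κ => (A ω.1, W ω.1, S ω.1 + ω.2))
      (Equiv.prodAssoc α β κ).symm]
  refine (congrArg _ (ent_withKey_add hp (fun ω => (A ω, W ω)) S)).trans ?_
  rw [info]
  ring

end OneTimePad

section Constraints

variable {Ω X : Type*} [Fintype Ω] [Fintype X] {n MW MS : ℕ} {Xn : Ω → Fin n → X} {W : Ω → Fin MW}
  {S S' : Ω → Fin MS} {ℓ w δ : ℝ} {R : ℝ × ℝ × ℝ}

lemma MeetsBounds.meetsConstraints {P : PMF Ω} (hn : 0 < n)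
    (h : MeetsBounds (wt P) Xn W S S' (n * ℓ) (n * w) δ) (hrate : R.1 = Real.log MS / n)
    (hℓ : ℓ ≤ R.2.1 + δ) (hw : w ≤ R.2.2 + δ) : MeetsConstraints P Xn S S' W R δ := by
  have hp := wt_mem_stdSimplex P
  have n_pos : (0 : ℝ) < n := Nat.cast_pos.2 hn
  have one_le : (1 : ℝ) ≤ n := Nat.one_le_cast.2 hn
  have δ_nonneg : 0 ≤ δ := (pr_nonneg hp.1 _).trans h.error_le
  refine ⟨hrate, (prob_eq_pr P _).trans_le h.error_le, ?_, ?_, ?_, ?_⟩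
  · rw [mutualInfo_eq_info]
    exact (info_le_deficit hp S W).trans h.secrecy_le
  · rw [mutualInfo_eq_info, info_comm, div_le_iff₀' n_pos]
    calc info (wt P) W Xn ≤ n * ℓ := (info_le_deficit hp W Xn).trans h.leakage_le
      _ ≤ n * (R.2.1 + δ) := by gcongr
  · rw [rvEntropy_eq_ent, hrate, le_div_iff₀ n_pos, sub_mul, div_mul_cancel₀ _ n_pos.ne']
    have gap := (log_card_sub_ent_le_deficit hp S W).trans h.secrecy_le
    rw [Fintype.card_fin] at gap
    linarith [le_mul_of_one_le_right δ_nonneg one_le]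
  · exact ((div_le_iff₀' n_pos).2 h.storage_le).trans hw

lemma MeetsBounds.meetsConstraints_pad [NeZero MS] {p : Ω → ℝ} (hp : p ∈ stdSimplex ℝ Ω)
    {P : PMF (Ω × Fin MS)} (hP : wt P = withKey (Fin MS) p) (hn : 0 < n)
    (h : MeetsBounds p Xn W S S' (n * ℓ) (n * w) δ) (hrate : R.1 = Real.log MS / n)
    (hℓ : ℓ ≤ R.2.1 + δ) (hw : w + R.1 ≤ R.2.2 + δ) :
    MeetsConstraints P (fun ω => Xn ω.1) (fun ω => ω.2) (fun ω => S ω.1 + ω.2 - S' ω.1)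
      (fun ω => finProdFinEquiv (W ω.1, S ω.1 + ω.2)) R δ := by
  have n_pos : (0 : ℝ) < n := Nat.cast_pos.2 hn
  have δ_nonneg : 0 ≤ δ := (pr_nonneg hp.1 _).trans h.error_le
  obtain ⟨ω⟩ := nonempty_of_mem_stdSimplex hp
  refine ⟨hrate, ?_, ?_, ?_, ?_, ?_⟩
  · rw [prob_eq_pr, hP]
    refine (pr_congr fun ω => ?_).trans_le ((pr_withKey_fst p _).trans_le h.error_le)
    simp [eq_sub_iff_add_eq', eq_comm]
  · rw [mutualInfo_eq_info, hP, info_comp_equiv_right, info_withKey_snd_pad hp]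
    exact h.secrecy_le
  · rw [mutualInfo_eq_info, hP, info_comp_equiv_right, info_withKey_fst_pad hp, info_comm,
      div_le_iff₀' n_pos]
    calc info p W Xn ≤ n * ℓ := (info_le_deficit hp W Xn).trans h.leakage_le
      _ ≤ n * (R.2.1 + δ) := by gcongr
  · rw [rvEntropy_eq_ent, hP, ent_withKey_snd hp, hrate, Fintype.card_fin]
    linarith
  · have MW_ne : (MW : ℝ) ≠ 0 := Nat.cast_ne_zero.2 (W ω).pos.ne'
    have storage := (div_le_iff₀' n_pos).2 h.storage_le
    rw [Nat.cast_mul, Real.log_mul MW_ne (Nat.cast_ne_zero.2 (NeZero.ne MS)), add_div, ← hrate]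
    linarith

end Constraints

section Achievability

variable {X Xt Y : Type*} [Fintype X] [Fintype Xt] [Fintype Y] (PX : PMF X)
  (BC : X → PMF (Xt × Y))

/-- The rate `r` is the exact key rate of codes with leakage at most `ℓ` and storage at most `w` up
to an arbitrarily small error, all measured by `MeetsBounds`. Such codes serve both models: the
generated key either is the secret or encrypts it. -/
def DeficitAchievable (r ℓ w : ℝ) : Prop :=
  ∀ δ : ℝ, 0 < δ → ∃ (n MW MS : ℕ) (_ : NeZero MS), 0 < n ∧ r = Real.log MS / n ∧
    ∃ (f : (Fin n → Xt) → Fin MW × Fin MS) (g : Fin MW × (Fin n → Y) → Fin MS),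
      MeetsBounds (prodWeight (Fin n) (wt (sourceLaw PX BC)))
        (fun z i => (z i).1)
        (fun z => (f fun i => (z i).2.1).1)
        (fun z => (f fun i => (z i).2.1).2)
        (fun z => g ((f fun i => (z i).2.1).1, fun i => (z i).2.2))
        (n * (ℓ + δ)) (n * (w + δ)) δ

variable {PX BC} {r ℓ w : ℝ}

lemma DeficitAchievable.achievableGS (h : DeficitAchievable PX BC r ℓ w) {R : ℝ × ℝ}
    (hℓ : ℓ ≤ R.1) (hw : w ≤ R.2) : AchievableGS PX BC (r, R) := fun δ hδ => by
  obtain ⟨n, MW, MS, _, hn, hrate, f, g, bounds⟩ := h δ hδ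
  rw [← wt_iid] at bounds
  exact ⟨n, MW, MS, hn, f, g, bounds.meetsConstraints hn hrate (by simpa) (by simpa)⟩

lemma wt_chosenLaw (n MS : ℕ) [NeZero MS] : wt (chosenLaw PX BC n MS) =
    withKey (Fin MS) (prodWeight (Fin n) (wt (sourceLaw PX BC))) := by
  ext ⟨z, s⟩
  refine (wt_bind_map _ _ (fun _ _ _ _ h => Prod.mk.inj h) z s).trans ?_
  rw [wt_iid, withKey]
  simp [wt]

lemma DeficitAchievable.achievableCS (h : DeficitAchievable PX BC r ℓ w) {R : ℝ × ℝ}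
    (hℓ : ℓ ≤ R.1) (hw : w + r ≤ R.2) : AchievableCS PX BC (r, R) := fun δ hδ => by
  obtain ⟨n, MW, MS, _, hn, hrate, f, g, bounds⟩ := h δ hδ
  refine ⟨n, MW * MS, MS, inferInstance, hn,
    fun x => finProdFinEquiv ((f x.1).1, (f x.1).2 + x.2),
    fun y => (finProdFinEquiv.symm y.1).2 - g ((finProdFinEquiv.symm y.1).1, y.2), ?_⟩
  have padded := bounds.meetsConstraints_pad (R := (r, R))
    (prodWeight_mem_stdSimplex (wt_mem_stdSimplex _)) (wt_chosenLaw n MS) hn hrate (by simpa)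
    (show w + δ + r ≤ R.2 + δ by linarith)
  simp only [Equiv.symm_apply_apply]
  exact padded

lemma deficit_eq_zero_of_unique {Ω α β : Type*} [Fintype Ω] [Fintype α] [Fintype β] [Unique α]
    (p : Ω → ℝ) (A : Ω → α) (B : Ω → β) : deficit p A B = 0 := by
  rw [deficit, ← ent_comp_equiv p (fun ω => (A ω, B ω)) (Equiv.uniqueProd β α)]
  simp

lemma deficitAchievable_zero (hℓ : 0 ≤ ℓ) (hw : 0 ≤ w) : DeficitAchievable PX BC 0 ℓ w :=
  fun δ hδ => ⟨1, 1, 1, inferInstance, one_pos, by simp, fun _ => (0, 0), fun _ => 0,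
    (deficit_eq_zero_of_unique _ _ _).trans_le (by positivity), by simpa using by positivity,
    (pr_eq_zero (by simp)).trans_le hδ.le, (deficit_eq_zero_of_unique _ _ _).trans_le hδ.le⟩

variable {m : ℕ} (Q : Xt → PMF (Fin m))

lemma infoUY_le_infoUXt : infoUY PX BC Q ≤ infoUXt PX BC Q := by
  have data_processing := info_joint_le_info_joint_self (B := fun z : X × Xt × Y => z.2.1)
    (wt_mem_stdSimplex (sourceLaw PX BC)) (fun t => wt_mem_stdSimplex (Q t)) fun z => z.2.2
  rwa [info_joint_eq_mutualInfo PX BC Q fun z => z.2.2,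
    info_joint_eq_mutualInfo PX BC Q fun z => z.2.1] at data_processing

lemma deficitAchievable_of_lt {a b : ℕ} (hb : 0 < b)
    (h : (a : ℝ) / b * Real.log 2 < infoUY PX BC Q) :
    DeficitAchievable PX BC (a / b * Real.log 2) (max 0 (infoUX PX BC Q - infoUY PX BC Q))
      (infoUXt PX BC Q - infoUY PX BC Q) := fun δ hδ => by
  obtain ⟨N, code⟩ := Filter.eventually_atTop.1 (eventually_exists_code (q := fun t => wt (Q t))
    (A := fun z : X × Xt × Y => z.1) (B := fun z : X × Xt × Y => z.2.1)
    (C := fun z : X × Xt × Y => z.2.2) (wt_mem_stdSimplex (sourceLaw PX BC))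
    (fun t => wt_mem_stdSimplex (Q t)) (info_joint_eq_mutualInfo PX BC Q fun z => z.2.1)
    (info_joint_eq_mutualInfo PX BC Q fun z => z.1)
    (info_joint_eq_mutualInfo PX BC Q fun z => z.2.2) h hδ)
  have : (0 : ℝ) < b := Nat.cast_pos.2 hb
  have rate : Real.log (2 ^ (a * (N + 1)) : ℕ) =
      (b * (N + 1) : ℕ) * (a / b * Real.log 2) := by
    push_cast
    rw [Real.log_pow]
    push_cast
    field_simp
  obtain ⟨MW, f, g, bounds⟩ := code (b * (N + 1))
    (N.le_succ.trans (Nat.le_mul_of_pos_left _ hb)) (2 ^ (a * (N + 1))) rate.le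
  refine ⟨b * (N + 1), MW, 2 ^ (a * (N + 1)), inferInstance, by positivity, ?_, f, g, bounds⟩
  rw [rate, mul_div_cancel_left₀ _ (by positivity)]

lemma mem_closure_deficitAchievable (hr : 0 ≤ r) (hr_le : r ≤ infoUY PX BC Q) :
    r ∈ closure {r' | r' ≤ r ∧ DeficitAchievable PX BC r'
      (max 0 (infoUX PX BC Q - infoUY PX BC Q)) (infoUXt PX BC Q - infoUY PX BC Q)} := by
  rcases hr.eq_or_lt with rfl | r_pos
  · exact subset_closure ⟨le_rfl, deficitAchievable_zero (le_max_left _ _)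
      (sub_nonneg.2 (infoUY_le_infoUXt Q))⟩
  · have mem_closure_Ico : r ∈ closure (Set.Ico 0 r) :=
      (closure_Ico r_pos.ne).symm ▸ Set.right_mem_Icc.2 hr
    refine closure_minimal (fun c (hc : 0 ≤ c ∧ c < r) => ?_) isClosed_closure mem_closure_Ico
    obtain ⟨c_nonneg, c_lt⟩ := hc
    have log_pos : 0 < Real.log 2 := Real.log_pos one_lt_two
    have lim := ((tendsto_nat_floor_mul_div_atTop (div_nonneg c_nonneg log_pos.le)).comp
      tendsto_natCast_atTop_atTop).mul_const (Real.log 2)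
    rw [div_mul_cancel₀ c log_pos.ne'] at lim
    refine mem_closure_of_tendsto lim ((Filter.eventually_gt_atTop 0).mono fun b hb => ?_)
    have rate_le : (⌊c / Real.log 2 * b⌋₊ : ℝ) / b * Real.log 2 ≤ c := by
      rw [← le_div_iff₀ log_pos, div_le_iff₀ (Nat.cast_pos.2 hb)]
      exact Nat.floor_le (by positivity)
    exact ⟨rate_le.trans c_lt.le,
      deficitAchievable_of_lt Q hb ((rate_le.trans_lt c_lt).trans_le hr_le)⟩

lemma regionGS_subset_capacityGS : regionGS PX BC ⊆ capacityGS PX BC := by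
  simp only [regionGS, Set.iUnion_subset_iff]
  rintro m Q ⟨r, R⟩ ⟨hr, hr_le, hℓ, hw⟩
  exact map_mem_closure (f := fun r' => (r', R)) (by fun_prop)
    (mem_closure_deficitAchievable Q hr hr_le) fun r' h => h.2.achievableGS hℓ hw

lemma regionCS_subset_capacityCS : regionCS PX BC ⊆ capacityCS PX BC := by
  simp only [regionCS, Set.iUnion_subset_iff]
  rintro m Q ⟨r, R⟩ ⟨hr, hr_le, hℓ, hw⟩
  exact map_mem_closure (f := fun r' => (r', R)) (by fun_prop)
    (mem_closure_deficitAchievable Q hr hr_le) fun r' h => h.2.achievableCS hℓ (by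
      dsimp only at hr_le hw
      linarith [h.1])

end Achievability

end KeyAgreement

end

open KeyAgreement in
theorem theorem1 {X Xt Y : Type*} [Fintype X] [Fintype Xt] [Fintype Y]
    (PX : PMF X) (BC : X → PMF (Xt × Y)) :
    -- inner bounds
    regionGS PX BC ⊆ capacityGS PX BC ∧
    regionCS PX BC ⊆ capacityCS PX BC ∧
    -- `|U| ≤ |X̃| + 2` suffices
    region1 PX BC ⊤ = region1 PX BC (Fintype.card Xt + 2) ∧
    region3 PX BC ⊤ = region3 PX BC (Fintype.card Xt + 2) ∧
    region2 PX BC ⊤ = region2 PX BC (Fintype.card Xt + 2) ∧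
    region4 PX BC ⊤ = region4 PX BC (Fintype.card Xt + 2) ∧
    -- `|U| ≤ |X̃| + 1` suffices to preserve the bounds on the key and storage rates
    (∀ (m : ℕ) (Q : Xt → PMF (Fin m)),
      ∃ m' ≤ Fintype.card Xt + 1, ∃ Q' : Xt → PMF (Fin m'),
        infoUY PX BC Q' = infoUY PX BC Q ∧ infoUXt PX BC Q' = infoUXt PX BC Q) ∧
    -- `|U| ≤ |X̃| + 1` suffices if the leakage bound is zero for every `P_{U|X̃}`
    ((∀ (m : ℕ) (Q : Xt → PMF (Fin m)), infoUX PX BC Q ≤ infoUY PX BC Q) →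
      region2 PX BC ⊤ = region2 PX BC (Fintype.card Xt + 1) ∧
      region4 PX BC ⊤ = region4 PX BC (Fintype.card Xt + 1)) := by
  have suffices_two := alphabetSuffices_card_add_two PX BC
  exact ⟨regionGS_subset_capacityGS, regionCS_subset_capacityCS, mod_cast suffices_two.region1_eq,
    mod_cast suffices_two.region3_eq, mod_cast suffices_two.region2_eq,
    mod_cast suffices_two.region4_eq,
    fun _ Q => exists_alphabet_preserving_key_storage PX BC Q, fun leak_le =>
      have suffices_one := alphabetSuffices_card_add_one PX BC leak_le
      ⟨mod_cast suffices_one.region2_eq, mod_cast suffices_one.region4_eq⟩⟩
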